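/- **Setting.** A network has $n$ sensors of $K$ types, $n_k\ge 1$ of them of type $k$ ($\sum_k n_k=n$). A type-$k$ sensor has sample density $p_{0,k}$ if unaffected and $p_{1,k}$ if affected, with respect to a $\sigma$-finite measure $\mu$ on a measurable space. The groups are $1,\dots,2K$: group $j\le K$ consists of the unaffected sensors of type $j$ (density $p_{0,j}$), group $K+j$ of the affected ones of type $j$ (density $p_{1,j}$). $\mathcal S_{n,0}$ is the set of labels $\sigma:\{1,\dots,n\}\to\{1,\dots,2K\}$ taking each value $j\le K$ exactly $n_j$ times and no other value; for $1\le k\le K$, $\mathcal S_{n,k}$ is the set of labels taking the value $k$ exactly $n_k-1$ times, the value $K+k$ once, each value $j\le K$, $j\ne k$, exactly $n_j$ times, and no other value. For a label $\sigma$ let $\mathbb P_\sigma$ be the product over $i=1,\dots,n$ of the densities of the groups $\sigma(i)$. Set $$\widetilde{\mathbb P}_0=\frac1{|\mathcal S_{n,0}|}\sum_{\sigma\in\mathcal S_{n,0}}\mathbb P_\sigma,\qquad \widetilde{\mathbb P}^k=\frac1{|\mathcal S_{n,k}|}\sum_{\sigma\in\mathcal S_{n,k}}\mathbb P_\sigma,\qquad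 I_k=D(\widetilde{\mathbb P}^k\,\|\,\widetilde{\mathbb P}_0),\qquad I^*=\min_{1\le k\le K}I_k .$$ The data vectors $X^n[1],X^n[2],\dots$ are independent. Under $\mathbb P^{k,\nu}_{\Omega}$ (static anomaly of type $k$ with change point $\nu\ge1$ and label sequence $\Omega=(\sigma_t)_{t\ge1}$), $X^n[t]\sim\mathbb P_{\sigma_t}$ with $\sigma_t\in\mathcal S_{n,0}$ for $t<\nu$ and $\sigma_t\in\mathcal S_{n,k}$ for $t\ge\nu$; under $\mathbb P^\infty_\Omega$ all $\sigma_t\in\mathcal S_{n,0}$. For a stopping time $\tau$ of the filtration generated by the data vectors, with values in $\{0,1,\dots\}\cup\{\infty\}$, let $$\mathrm{WADD}(\tau)=\sup_{\nu\ge1}\sup_{k}\sup_{\Omega}\operatorname{ess\,sup}\mathbb E^{k,\nu}_{\Omega}\big[(\tau-\nu)^+\,\big|\,X^n[1],\dots,X^n[\nu-1]\big],\qquad \mathrm{WARL}(\tau)=\inf_\Omega\mathbb E^\infty_\Omega[\tau].$$ The GM-CuSum stopping time with threshold $b$ is $$T_G=\inf\{t\ge1: W[t]\ge b\},\qquad W[t]=\max_{1\le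 k\le K}\max_{1\le j\le t}\sum_{i=j}^t\log\frac{\widetilde{\mathbb P}^k(X^n[i])}{\widetilde{\mathbb P}_0(X^n[i])}.$$ **Theorem 3.** Assume $0<I^*<\infty$, and let $T_G$ have the threshold $b=\log(K\gamma)$. 1. For every $\gamma>0$, $T_G$ is a stopping time with $\mathrm{WARL}(T_G)\ge\gamma$. 2. As $\gamma\to\infty$, $\displaystyle\inf_{\tau:\mathrm{WARL}(\tau)\ge\gamma}\mathrm{WADD}(\tau)\ \ge\ \frac{\log\gamma}{I^*}+O(1)$. 3. Suppose in addition that, for every $k$ with $I_k=I^*$, $\log(\widetilde{\mathbb P}^k/\widetilde{\mathbb P}_0)$ has a finite second moment under $\widetilde{\mathbb P}^k$. Then $T_G$ is second-order asymptotically optimal: as $\gamma\to\infty$, $$\mathrm{WADD}(T_G)=\frac{\log\gamma}{I^*}+O(1)\qquad\text{and}\qquad \mathrm{WADD}(T_G)\le\inf_{\tau:\mathrm{WARL}(\tau)\ge\gamma}\mathrm{WADD}(\tau)+O(1).$$ -/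

import Mathlib

open MeasureTheory ProbabilityTheory Filter
open scoped ENNReal NNReal

noncomputable section

namespace UnlabeledQCD

/-- A network of `n` sensors of `K` types, observed in the space `X`. The pre- and post-anomaly
data-generating distributions of a type-`k` sensor are given by their densities `p0 k`, `p1 k` with
respect to the reference measure `μ`. Every type is represented by at least one sensor. -/
structure SensorNetwork {X : Type*} [MeasurableSpace X] (μ : Measure X) (K n : ℕ) where
  /-- the number of sensors of each type -/
  count : Fin K → ℕ
  count_pos : ∀ k, 0 < count k
  sum_count : ∑ k, count k = n
  /-- density of an unaffected sensor of type `k` -/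
  p0 : Fin K → X → ℝ≥0
  /-- density of an affected sensor of type `k` -/
  p1 : Fin K → X → ℝ≥0
  measurable_p0 : ∀ k, Measurable (p0 k)
  measurable_p1 : ∀ k, Measurable (p1 k)
  lintegral_p0 : ∀ k, ∫⁻ x, p0 k x ∂μ = 1
  lintegral_p1 : ∀ k, ∫⁻ x, p1 k x ∂μ = 1

/-- The `2K` groups: `Sum.inl k` are the unaffected sensors of type `k`, `Sum.inr k` the affected
ones. -/
abbrev Group (K : ℕ) : Type := Fin K ⊕ Fin K

/-- Trajectory of a static anomaly of type `k` with change point `ν`: `none` means that no sensor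
is affected, `some k` that one sensor of type `k` is. Coordinate `i` of a sequence stands for the
time `i + 1` throughout, so that times start from `1`. -/
def staticTrajectory {K : ℕ} (k : Fin K) (ν : ℕ) : ℕ → Option (Fin K) :=
  fun i => if i + 1 < ν then none else some k

/-- The trajectory without anomaly (`ν = ∞`). -/
def noAnomaly (K : ℕ) : ℕ → Option (Fin K) := fun _ => none

/-- The `σ`-algebra generated by the samples of the times `1, …, t`. -/
abbrev history (Y : Type*) [MeasurableSpace Y] (t : ℕ) : MeasurableSpace (ℕ → Y) :=
  MeasureTheory.cylinderEvents (Set.Iio t)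

/-- The filtration of the received samples. -/
def sampleFiltration (Y : Type*) [MeasurableSpace Y] :
    Filtration ℕ (MeasurableSpace.pi : MeasurableSpace (ℕ → Y)) where
  seq := history Y
  mono' _ _ h := MeasureTheory.cylinderEvents_mono (Set.Iio_subset_Iio h)
  le' _ := MeasureTheory.cylinderEvents_le_pi

namespace SensorNetwork

variable {X : Type*} [MeasurableSpace X] {μ : Measure X} {K n : ℕ} (N : SensorNetwork μ K n)

/-- The density of the samples of a group. -/
def groupDensity : Group K → X → ℝ≥0
  | Sum.inl k => N.p0 k
  | Sum.inr k => N.p1 k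

/-- The number of sensors in a group, when the anomaly state is `s`. -/
def groupSize (s : Option (Fin K)) : Group K → ℕ
  | Sum.inl k => if s = some k then N.count k - 1 else N.count k
  | Sum.inr k => if s = some k then 1 else 0

/-- The set of labels `σ : {1, …, n} → groups` that are possible when the anomaly state is `s`. -/
def Label (s : Option (Fin K)) : Type :=
  {σ : Fin n → Group K // ∀ g, (Finset.univ.filter fun i => σ i = g).card = N.groupSize s g}

instance (s : Option (Fin K)) : Fintype (N.Label s) :=
  inferInstanceAs (Fintype {σ : Fin n → Group K //
    ∀ g, (Finset.univ.filter fun i => σ i = g).card = N.groupSize s g})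

/-- The law of the data vector of one time step under the label `σ`. -/
def sampleLaw {s : Option (Fin K)} (σ : N.Label s) : Measure (Fin n → X) :=
  Measure.pi fun i => μ.withDensity fun x => (N.groupDensity (σ.1 i) x : ℝ≥0∞)

/-- The uniform mixture of the laws of the data vector over all possible labels. -/
def mixtureLaw (s : Option (Fin K)) : Measure (Fin n → X) :=
  (Fintype.card (N.Label s) : ℝ≥0∞)⁻¹ • ∑ σ : N.Label s, N.sampleLaw σ

/-- The density of `mixtureLaw`. -/
def mixtureDensity (s : Option (Fin K)) (x : Fin n → X) : ℝ≥0 :=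
  (Fintype.card (N.Label s) : ℝ≥0)⁻¹ * ∑ σ : N.Label s, ∏ i, N.groupDensity (σ.1 i) (x i)

/-- The log-likelihood ratio of the mixtures, with the values `-∞` and `+∞` where only the
numerator or only the denominator vanishes. -/
def mixtureLLR (k : Fin K) (x : Fin n → X) : EReal :=
  ENNReal.log ((N.mixtureDensity (some k) x : ℝ≥0∞) / (N.mixtureDensity none x : ℝ≥0∞))

/-- The Kullback-Leibler divergence of the mixture for type `k` from the pre-change mixture. -/
def klInfo (k : Fin K) : ℝ≥0∞ :=
  InformationTheory.klDiv (N.mixtureLaw (some k)) (N.mixtureLaw none)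

/-- The minimum over the types of `klInfo`. -/
def klInfoMin : ℝ≥0∞ := ⨅ k, N.klInfo k

/-- The law of the sequence of data vectors, independent over time, when the trajectory of the
anomaly is `S` and the samples are labelled by `L`. -/
def pathLaw {S : ℕ → Option (Fin K)} (L : ∀ i, N.Label (S i)) : Measure (ℕ → Fin n → X) :=
  Measure.infinitePi fun i => N.sampleLaw (L i)

/-- Worst-case average running length to false alarm. -/
def WARL (τ : (ℕ → Fin n → X) → WithTop ℕ) : ℝ≥0∞ :=
  ⨅ L : ∀ i, N.Label (noAnomaly K i), ∫⁻ x, ENat.toENNReal (τ x) ∂(N.pathLaw L)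

/-- Worst-case average detection delay, over the change points `ν ≥ 1`, the affected types, the
labels and (by the essential supremum) the samples before the change. -/
def WADD (τ : (ℕ → Fin n → X) → WithTop ℕ) : ℝ≥0∞ :=
  ⨆ (ν : ℕ) (_ : 1 ≤ ν) (k : Fin K) (L : ∀ i, N.Label (staticTrajectory k ν i)),
    essSup (condLExp (history (Fin n → X) (ν - 1)) (N.pathLaw L)
      fun x => ENat.toENNReal (τ x) - (ν : ℝ≥0∞)) (N.pathLaw L)

/-- The optimal worst-case delay under the constraint that the `WARL` is at least `γ`. -/
def optimalWADD (γ : ℝ) : ℝ≥0∞ :=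
  ⨅ (τ : (ℕ → Fin n → X) → WithTop ℕ)
    (_ : IsStoppingTime (sampleFiltration (Fin n → X)) τ) (_ : ENNReal.ofReal γ ≤ N.WARL τ),
    N.WADD τ

/-- The statistic `W[t]`: the maximum over the types `k` and the starting times `j + 1 ≤ t` of the
sum of the log-likelihood ratios of the times `j + 1, …, t`. -/
def statistic (t : ℕ) (x : ℕ → Fin n → X) : EReal :=
  ⨆ (k : Fin K) (j : Fin t), ∑ i ∈ Finset.Ico (j : ℕ) t, N.mixtureLLR k (x i)

/-- The GM-CuSum stopping time with threshold `b`: the first `t ≥ 1` with `W[t] ≥ b`. -/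
def gmCuSum (b : ℝ) : (ℕ → Fin n → X) → WithTop ℕ :=
  hittingAfter N.statistic (Set.Ici (b : EReal)) 1

end SensorNetwork

end UnlabeledQCD

end

/-! The mixture likelihood ratios `mixtureLR k` are symmetric in the sensors, and a symmetric
function of the data vector has the same law under every label (`lintegral_sampleLaw_eq`). Whatever
the labels are, the GM-CuSum statistic thus behaves as if each data vector were drawn from the
mixture.

False alarms (`le_WARL_gmCuSum`): the sum over the types of the Shiryaev–Roberts statistics, minus
`K t`, is a supermartingale before the change, and this sum dominates `exp W[t]`. It is at least `K
γ` when the procedure stops, so optional stopping gives `K γ ≤ K E[T]`.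

Delay (`exists_WADD_gmCuSum_le`): after the change, `W` dominates the random walk of the
log-likelihood ratios of the true type started at the change point. A Lyapunov function
(`exists_passage_lyapunov`) bounds its mean passage time by `b / mean + O(1)` when the positive part
of the increments has a second moment. If `I_k > I*`, the increments can be truncated from above
with a mean that is still at least `I*`, so the moment condition is only needed for the minimizing
types.

Lower bound (`exists_le_optimalWADD_add`): averaging over uniform labels turns any admissible
procedure into one for the i.i.d. change from `Q`, the pre-change mixture, to `Q'`, the mixture of a
least informative type. If `d` bounds its conditional delays, weighting the change point after `s`
samples by `(1 - M_s)⁺`, with `M` the multiplicative CuSum process, gives Moustakides' inequality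
(`sum_lintegral_max_one_cusum_le`). A second Lyapunov function (`cusumLyapunov`) absorbs both sides
of it and leaves `δ E[τ] ≤ exp (I (d + 2)) / I`, where `1 - δ` is the Bhattacharyya coefficient of
`Q` and `Q'`. Taking logarithms gives the bound up to `O(1)`. -/

noncomputable section

namespace UnlabeledQCD

/-! ### Infinite product measures: freezing, change of measure, mixtures. -/

section ProductMeasures

variable {Y : Type*} [MeasurableSpace Y]

lemma history_le_pi (t : ℕ) : history Y t ≤ MeasurableSpace.pi := cylinderEvents_le_pi

lemma history_mono {s t : ℕ} (h : s ≤ t) : history Y s ≤ history Y t :=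
  cylinderEvents_mono (Set.Iio_subset_Iio h)

lemma history_eq_comap (t : ℕ) :
    history Y t = MeasurableSpace.comap (Set.Iio t).domRestrict MeasurableSpace.pi := by
  simp only [history, cylinderEvents, MeasurableSpace.pi, MeasurableSpace.comap_iSup,
    MeasurableSpace.comap_comp]
  rw [iSup_subtype']
  rfl

lemma measurable_eval_history {i t : ℕ} (h : i < t) :
    Measurable[history Y t] fun x : ℕ → Y => x i :=
  measurable_cylinderEvent_apply (X := fun _ => Y) (Set.mem_Iio.2 h)

lemma lintegral_prodMk_of_indepFun {Ω β γ : Type*} {mΩ : MeasurableSpace Ω}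
    {mβ : MeasurableSpace β} {mγ : MeasurableSpace γ} {Q : Measure Ω} [IsProbabilityMeasure Q]
    {f : Ω → β} {g : Ω → γ} (hf : Measurable f) (hg : Measurable g) (h : IndepFun f g Q)
    {F : β × γ → ℝ≥0∞} (hF : Measurable F) :
    ∫⁻ x, F (f x, g x) ∂Q = ∫⁻ x, ∫⁻ y, F (f x, y) ∂(Q.map g) ∂Q := by
  have : IsProbabilityMeasure (Q.map g) := Measure.isProbabilityMeasure_map hg.aemeasurable
  have h1 := (indepFun_iff_map_prod_eq_prod_map_map hf.aemeasurable hg.aemeasurable).1 h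
  rw [← lintegral_map hF (hf.prodMk hg), h1, lintegral_prod _ hF.aemeasurable,
    lintegral_map hF.lintegral_prod_right' hf]

/-- Freezing lemma: under a product measure, the coordinate `t` may be integrated first, with the
coordinates before `t` held fixed. -/
lemma lintegral_infinitePi_history_eval (P : ℕ → Measure Y) [∀ i, IsProbabilityMeasure (P i)]
    (t : ℕ) {F : (ℕ → Y) × Y → ℝ≥0∞} (hF : Measurable[(history Y t).prod inferInstance] F) :
    ∫⁻ x, F (x, x t) ∂Measure.infinitePi P =
      ∫⁻ x, ∫⁻ y, F (x, y) ∂P t ∂Measure.infinitePi P := by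
  have hind : iIndep (fun i => MeasurableSpace.comap (fun x : ℕ → Y => x i) inferInstance)
      (Measure.infinitePi P) :=
    iIndepFun_infinitePi (P := P) (X := fun _ => id) fun _ => measurable_id
  have h1 := indep_iSup_of_disjoint (S := Set.Iio t) (T := {t})
    (fun i => (measurable_pi_apply i).comap_le) hind (by simp)
  have h2 : @IndepFun _ _ _ MeasurableSpace.pi (history Y t) _ id (fun x : ℕ → Y => x t)
      (Measure.infinitePi P) := by
    refine (@IndepFun_iff_Indep _ _ _ MeasurableSpace.pi (history Y t) _ _ _ _).2 ?_
    rw [MeasurableSpace.comap_id]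
    simpa [history, cylinderEvents] using h1
  have h3 := @lintegral_prodMk_of_indepFun _ _ _ MeasurableSpace.pi (history Y t) _ _ _ id
    (fun x : ℕ → Y => x t) (measurable_id'' (history_le_pi t)) (measurable_pi_apply t) h2 F hF
  rwa [Measure.infinitePi_map_eval] at h3

lemma lintegral_infinitePi_mul_eval (P : ℕ → Measure Y) [∀ i, IsProbabilityMeasure (P i)]
    (t : ℕ) {f : (ℕ → Y) → ℝ≥0∞} (hf : Measurable[history Y t] f) {g : Y → ℝ≥0∞}
    (hg : Measurable g) :
    ∫⁻ x, f x * g (x t) ∂Measure.infinitePi P =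
      (∫⁻ x, f x ∂Measure.infinitePi P) * ∫⁻ y, g y ∂P t := by
  have h := lintegral_infinitePi_history_eval P t (F := fun z => f z.1 * g z.2)
    (by
      let := history Y t
      exact (hf.comp measurable_fst).mul (hg.comp measurable_snd))
  simp only at h
  rw [h]
  simp_rw [lintegral_const_mul _ hg]
  rw [lintegral_mul_const _ (hf.mono (history_le_pi t) le_rfl)]

lemma lintegral_prod_infinitePi {α : ℕ → Type*} [∀ i, MeasurableSpace (α i)]
    (P : ∀ i, Measure (α i)) [∀ i, IsProbabilityMeasure (P i)]
    (s : Finset ℕ) {g : ∀ i, α i → ℝ≥0∞} (hg : ∀ i, Measurable (g i)) :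
    ∫⁻ x, ∏ i ∈ s, g i (x i) ∂Measure.infinitePi P = ∏ i ∈ s, ∫⁻ y, g i y ∂P i := by
  rw [lintegral_prod_eq_prod_lintegral_of_indepFun s (fun i (x : ∀ i, α i) => g i (x i))
    (iIndepFun_infinitePi (P := P) hg) (fun i => (hg i).comp (measurable_pi_apply i))]
  refine Finset.prod_congr rfl fun i _ => ?_
  rw [← lintegral_map (hg i) (measurable_pi_apply i), Measure.infinitePi_map_eval]

/-- On the events of the first `t` coordinates, a product measure depends only on its first `t`
factors. -/
lemma lintegral_infinitePi_congr_history {P P' : ℕ → Measure Y} [∀ i, IsProbabilityMeasure (P i)]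
    [∀ i, IsProbabilityMeasure (P' i)] {t : ℕ} (h : ∀ i < t, P i = P' i)
    {f : (ℕ → Y) → ℝ≥0∞} (hf : Measurable[history Y t] f) :
    ∫⁻ x, f x ∂Measure.infinitePi P = ∫⁻ x, f x ∂Measure.infinitePi P' := by
  rw [← lintegral_trim (history_le_pi t) hf, ← lintegral_trim (history_le_pi t) hf]
  congr 1
  refine @Measure.ext _ (history Y t) _ _ fun A hA => ?_
  rw [trim_measurableSet_eq _ hA, trim_measurableSet_eq _ hA]
  rw [history_eq_comap] at hA
  obtain ⟨B, hB, rfl⟩ := hA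
  have hr : Measurable ((Set.Iio t).domRestrict : (ℕ → Y) → _) := by fun_prop
  rw [← Measure.map_apply hr hB, ← Measure.map_apply hr hB, Measure.infinitePi_map_restrict',
    Measure.infinitePi_map_restrict']
  have : (fun i : Set.Iio t => P i) = fun i : Set.Iio t => P' i := funext fun i => h i i.2
  simp_rw [this]

/-- Change of measure on the events of the first `t` coordinates. -/
lemma lintegral_infinitePi_withDensity_history {P Q : ℕ → Measure Y}
    [∀ i, IsProbabilityMeasure (P i)] [∀ i, IsProbabilityMeasure (Q i)] {t : ℕ}
    {D : ℕ → Y → ℝ≥0∞} (hD : ∀ i, Measurable (D i)) (h : ∀ i < t, P i = (Q i).withDensity (D i))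
    {f : (ℕ → Y) → ℝ≥0∞} (hf : Measurable[history Y t] f) :
    ∫⁻ x, f x ∂Measure.infinitePi P =
      ∫⁻ x, f x * ∏ i ∈ Finset.range t, D i (x i) ∂Measure.infinitePi Q := by
  classical
  -- The full products of the `P i` and the `Q i` may be mutually singular. Replacing `P i` by `Q i`
  -- from `t` on changes nothing on the history and makes the finite product of densities valid on
  -- the whole space.
  set P' : ℕ → Measure Y := fun i => if i < t then P i else Q i with hP'
  have : ∀ i, IsProbabilityMeasure (P' i) := fun i => by
    simp only [hP']; split_ifs <;> infer_instance
  have hprod : Measurable fun x : ℕ → Y => ∏ i ∈ Finset.range t, D i (x i) :=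
    Finset.measurable_prod _ fun i _ => (hD i).comp (measurable_pi_apply i)
  have key : (Measure.infinitePi Q).withDensity (fun x => ∏ i ∈ Finset.range t, D i (x i)) =
      Measure.infinitePi P' := by
    refine Measure.eq_infinitePi _ fun s A hA => ?_
    have hS : MeasurableSet ((s : Set ℕ).pi A) := .pi s.countable_toSet fun i _ => hA i
    rw [withDensity_apply _ hS, ← lintegral_indicator hS]
    -- The box constrains `s` and the density involves `range t`. Padding both with factors 1 to the
    -- union yields a product of functions of single coordinates.
    have e : ∀ x : ℕ → Y, ((s : Set ℕ).pi A).indicator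
        (fun x => ∏ i ∈ Finset.range t, D i (x i)) x =
        ∏ i ∈ s ∪ Finset.range t, (if i ∈ s then (A i).indicator 1 (x i) else 1) *
          (if i < t then D i (x i) else 1) := by
      intro x
      rw [Finset.prod_mul_distrib, ← Finset.prod_subset (Finset.subset_union_left (s₁ := s))
        (f := fun i => if i ∈ s then (A i).indicator 1 (x i) else (1 : ℝ≥0∞)),
        ← Finset.prod_subset (Finset.subset_union_right (s₁ := s) (s₂ := Finset.range t))
        (f := fun i => if i < t then D i (x i) else (1 : ℝ≥0∞))]
      · rw [Finset.prod_congr rfl (g := fun i => (A i).indicator (1 : Y → ℝ≥0∞) (x i))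
          (fun i hi => by simp [hi]), Finset.prod_congr (s₁ := Finset.range t) rfl
          (g := fun i => D i (x i)) (fun i hi => by simp [Finset.mem_range.1 hi])]
        by_cases hx : x ∈ (s : Set ℕ).pi A
        · rw [Set.indicator_of_mem hx,
            Finset.prod_eq_one (f := fun i => (A i).indicator (1 : Y → ℝ≥0∞) (x i)), one_mul]
          intro i hi
          simp [hx i hi]
        · rw [Set.indicator_of_notMem hx]
          simp only [Set.mem_pi, not_forall] at hx
          obtain ⟨i, hi, hx⟩ := hx
          rw [Finset.prod_eq_zero (Finset.mem_coe.1 hi) (by simp [hx]), zero_mul]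
      · intro i _ hi; simp_all
      · intro i _ hi; simp [hi]
    simp_rw [e]
    rw [lintegral_prod_infinitePi Q (s ∪ Finset.range t)
      (g := fun i y => (if i ∈ s then (A i).indicator 1 y else 1) * (if i < t then D i y else 1))]
    · rw [← Finset.prod_subset (Finset.subset_union_left (s₁ := s))]
      · refine Finset.prod_congr rfl fun i hi => ?_
        simp only [hi, if_true, hP']
        split_ifs with hit
        · rw [h i hit, withDensity_apply _ (hA i), ← lintegral_indicator (hA i)]
          congr 1 with y
          by_cases hy : y ∈ A i <;> simp [hy]
        · simp [hA i]
      · intro i hi his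
        have hit : i < t := by simpa [his] using hi
        have hp : P i Set.univ = 1 := measure_univ
        rw [h i hit, withDensity_apply _ .univ] at hp
        simpa [his, hit] using hp
    · intro i
      split_ifs
      · exact (measurable_one.indicator (hA i)).mul (hD i)
      · exact (measurable_one.indicator (hA i)).mul measurable_const
      · exact measurable_const.mul (hD i)
      · fun_prop
  rw [lintegral_infinitePi_congr_history (P' := P') (fun i hi => by simp [hP', hi]) hf, ← key,
    lintegral_withDensity_eq_lintegral_mul _ hprod (hf.mono (history_le_pi t) le_rfl)]
  simp only [Pi.mul_apply, mul_comm]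

/-- A product of uniform mixtures is a mixture of products. -/
lemma lintegral_infinitePi_mixture_le {α : ℕ → Type*} [∀ i, Fintype (α i)] [∀ i, Nonempty (α i)]
    (ν : ∀ i, α i → Measure Y) [∀ i a, IsProbabilityMeasure (ν i a)]
    {P : ℕ → Measure Y} [∀ i, IsProbabilityMeasure (P i)]
    (hP : ∀ i, P i = (Fintype.card (α i) : ℝ≥0∞)⁻¹ • ∑ a, ν i a)
    {f g : (ℕ → Y) → ℝ≥0∞} (hf : Measurable f) (hg : Measurable g)
    (h : ∀ L : ∀ i, α i, ∫⁻ x, f x ∂Measure.infinitePi (fun i => ν i (L i)) ≤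
      ∫⁻ x, g x ∂Measure.infinitePi (fun i => ν i (L i))) :
    ∫⁻ x, f x ∂Measure.infinitePi P ≤ ∫⁻ x, g x ∂Measure.infinitePi P := by
  let : ∀ i, MeasurableSpace (α i) := fun _ => ⊤
  have : ∀ i, MeasurableSingletonClass (α i) := fun _ => ⟨fun _ => trivial⟩
  set U : ∀ i, Measure (α i) := fun i => (PMF.uniformOfFintype (α i)).toMeasure with hU
  set κ : (∀ i, α i) → Measure (ℕ → Y) := fun L => Measure.infinitePi fun i => ν i (L i) with hκ
  have hbox : ∀ L (s : Finset ℕ) (A : ℕ → Set Y), (∀ i, MeasurableSet (A i)) →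
      κ L ((s : Set ℕ).pi A) = ∏ i ∈ s, ν i (L i) (A i) := fun L s A hA =>
    Measure.infinitePi_pi _ fun i _ => hA i
  -- Measurability in the label sequence is only needed on boxes, where it involves finitely many
  -- labels, each from a finite discrete set.
  have hκm : Measurable κ := by
    refine Measurable.measure_of_isPiSystem_of_isProbabilityMeasure
      generateFrom_squareCylinders.symm
      (isPiSystem_squareCylinders (fun _ => MeasurableSpace.isPiSystem_measurableSet)
        (fun _ => MeasurableSet.univ)) ?_
    rintro _ ⟨s, A, hA, rfl⟩
    simp only [Set.mem_pi, Set.mem_univ, forall_const, Set.mem_ofPred_eq] at hA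
    simp_rw [hbox _ s A hA]
    exact Finset.measurable_prod _ fun i _ =>
      (measurable_of_finite fun a : α i => ν i a (A i)).comp (measurable_pi_apply i)
  have hbind : (Measure.infinitePi U).bind κ = Measure.infinitePi P := by
    refine Measure.eq_infinitePi _ fun s A hA => ?_
    rw [Measure.bind_apply (.pi s.countable_toSet fun i _ => hA i) hκm.aemeasurable]
    simp_rw [hbox _ s A hA]
    rw [lintegral_prod_infinitePi U s (g := fun i a => ν i a (A i))
      fun i => measurable_of_finite _]
    refine Finset.prod_congr rfl fun i _ => ?_
    rw [lintegral_fintype, hP i]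
    simp_rw [hU, PMF.toMeasure_apply_singleton _ _ (measurableSet_singleton _)]
    simp [Finset.mul_sum, mul_comm]
  rw [← hbind, Measure.lintegral_bind hκm.aemeasurable hf.aemeasurable,
    Measure.lintegral_bind hκm.aemeasurable hg.aemeasurable]
  exact lintegral_mono h

end ProductMeasures

lemma lintegral_pi_prod {X : Type*} [MeasurableSpace X] {μ : Measure X} [SigmaFinite μ] {n : ℕ}
    {f : Fin n → X → ℝ≥0∞} (hf : ∀ i, Measurable (f i)) :
    ∫⁻ x, ∏ i, f i (x i) ∂Measure.pi (fun _ => μ) = ∏ i, ∫⁻ y, f i y ∂μ := by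
  induction n with
  | zero => simp
  | succ n ih =>
    have h := (measurePreserving_piFinSuccAbove (fun _ : Fin (n + 1) => μ) 0).symm
    rw [← h.lintegral_comp (f := fun x => ∏ i, f i (x i))
      (Finset.measurable_prod _ fun i _ => (hf i).comp (measurable_pi_apply i))]
    simp only [Fin.prod_univ_succ]
    rw [← ih fun i => hf i.succ, ← lintegral_prod_mul (hf 0).aemeasurable
      (Finset.measurable_prod _ fun i _ => (hf i.succ).comp (measurable_pi_apply i)).aemeasurable]
    rfl

/-! ### Labels, permutations of the sensors and mixture laws. -/

namespace SensorNetwork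

variable {X : Type*} [MeasurableSpace X] {μ : Measure X} {K n : ℕ} (N : SensorNetwork μ K n)

lemma sum_groupSize (s : Option (Fin K)) : ∑ g, N.groupSize s g = n := by
  rw [Fintype.sum_sum_type, ← Finset.sum_add_distrib]
  refine (Finset.sum_congr rfl fun k _ => ?_).trans N.sum_count
  -- The affected sensor moves from one group to another; positivity is what makes the truncated
  -- `count k - 1 + 1` equal to `count k`.
  have := N.count_pos k
  by_cases h : s = some k <;> simp [groupSize, h]
  omega

instance nonempty_label (s : Option (Fin K)) : Nonempty (N.Label s) := by
  have e : Fin n ≃ Σ g : Group K, Fin (N.groupSize s g) :=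
    (Fintype.equivFinOfCardEq (by simpa using N.sum_groupSize s)).symm
  refine ⟨⟨fun i => (e i).1, fun g => ?_⟩⟩
  rw [← Fintype.card_subtype]
  have e' : {i // (e i).1 = g} ≃ Fin (N.groupSize s g) :=
    (e.subtypeEquiv (q := fun z => z.1 = g) fun _ => Iff.rfl).trans (Equiv.sigmaSubtype g)
  simpa using Fintype.card_congr e'

variable {N}

/-- Corresponding fibres of the two labels have equal size, and bijections between them glue
together. -/
lemma Label.exists_perm {s : Option (Fin K)} (σ σ' : N.Label s) :
    ∃ e : Equiv.Perm (Fin n), ∀ i, σ'.1 (e i) = σ.1 i := by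
  have h : ∀ g, Nonempty ({i // σ.1 i = g} ≃ {i // σ'.1 i = g}) := fun g => by
    rw [← Fintype.card_eq, Fintype.card_subtype, Fintype.card_subtype, σ.2, σ'.2]
  exact ⟨Equiv.ofFiberEquiv fun g => (h g).some, fun i => Equiv.ofFiberEquiv_map _ i⟩

/-- Relabelling of the sensors by a permutation. -/
def Label.permute {s : Option (Fin K)} (e : Equiv.Perm (Fin n)) (σ : N.Label s) : N.Label s :=
  ⟨fun i => σ.1 (e i), fun g => by
    rw [← σ.2 g, ← Fintype.card_subtype, ← Fintype.card_subtype]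
    exact Fintype.card_congr (e.subtypeEquiv fun _ => Iff.rfl)⟩

/-- `Label.permute` as a permutation of the labels. -/
def Label.permuteEquiv {s : Option (Fin K)} (e : Equiv.Perm (Fin n)) : N.Label s ≃ N.Label s where
  toFun := Label.permute e
  invFun := Label.permute e.symm
  left_inv σ := Subtype.ext (funext fun i => by simp [Label.permute])
  right_inv σ := Subtype.ext (funext fun i => by simp [Label.permute])

variable (N)

/-- Permuting the coordinates only permutes the labels over which the density is averaged. -/
lemma mixtureDensity_comp_perm (s : Option (Fin K)) (e : Equiv.Perm (Fin n)) (x : Fin n → X) :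
    N.mixtureDensity s (fun i => x (e i)) = N.mixtureDensity s x := by
  unfold mixtureDensity
  congr 1
  refine Fintype.sum_equiv (Label.permuteEquiv e.symm) _ _ fun σ => ?_
  refine Fintype.prod_equiv e _ _ fun i => ?_
  simp [Label.permuteEquiv, Label.permute]

lemma mixtureLLR_comp_perm (k : Fin K) (e : Equiv.Perm (Fin n)) (x : Fin n → X) :
    N.mixtureLLR k (fun i => x (e i)) = N.mixtureLLR k x := by
  simp only [mixtureLLR, mixtureDensity_comp_perm]

lemma measurable_groupDensity (g : Group K) : Measurable (N.groupDensity g) := by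
  cases g
  · exact N.measurable_p0 _
  · exact N.measurable_p1 _

lemma lintegral_groupDensity (g : Group K) : ∫⁻ x, N.groupDensity g x ∂μ = 1 := by
  cases g
  · exact N.lintegral_p0 _
  · exact N.lintegral_p1 _

lemma measurable_mixtureDensity (s : Option (Fin K)) : Measurable (N.mixtureDensity s) := by
  refine measurable_const.mul (Finset.measurable_sum _ fun σ _ => Finset.measurable_prod _
    fun i _ => (N.measurable_groupDensity _).comp (measurable_pi_apply i))

lemma measurable_mixtureLLR (k : Fin K) : Measurable (N.mixtureLLR k) :=
  ENNReal.measurable_log.comp ((N.measurable_mixtureDensity _).coe_nnreal_ennreal.div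
    (N.measurable_mixtureDensity _).coe_nnreal_ennreal)

instance isProbabilityMeasure_groupLaw (g : Group K) :
    IsProbabilityMeasure (μ.withDensity fun x => (N.groupDensity g x : ℝ≥0∞)) :=
  ⟨by rw [withDensity_apply _ .univ, setLIntegral_univ, N.lintegral_groupDensity g]⟩

instance isProbabilityMeasure_sampleLaw {s : Option (Fin K)} (σ : N.Label s) :
    IsProbabilityMeasure (N.sampleLaw σ) := by
  unfold sampleLaw; infer_instance

instance isProbabilityMeasure_mixtureLaw (s : Option (Fin K)) :
    IsProbabilityMeasure (N.mixtureLaw s) := by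
  constructor
  simp only [mixtureLaw, Measure.smul_apply, Measure.finsetSum_apply, measure_univ,
    Finset.sum_const, Finset.card_univ, nsmul_eq_mul, mul_one, smul_eq_mul]
  exact ENNReal.inv_mul_cancel (by simp [Fintype.card_ne_zero]) (by simp)

instance isProbabilityMeasure_pathLaw {S : ℕ → Option (Fin K)} (L : ∀ i, N.Label (S i)) :
    IsProbabilityMeasure (N.pathLaw L) := by
  unfold pathLaw; infer_instance

/-- The law of the sequence of data vectors, independent over time, with the labels of each time
chosen uniformly at random. -/
def mixturePathLaw (S : ℕ → Option (Fin K)) : Measure (ℕ → Fin n → X) :=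
  Measure.infinitePi fun i => N.mixtureLaw (S i)

instance isProbabilityMeasure_mixturePathLaw (S : ℕ → Option (Fin K)) :
    IsProbabilityMeasure (N.mixturePathLaw S) := by
  unfold mixturePathLaw; infer_instance

lemma lintegral_mixturePathLaw_le {S : ℕ → Option (Fin K)} {f g : (ℕ → Fin n → X) → ℝ≥0∞}
    (hf : Measurable f) (hg : Measurable g)
    (h : ∀ L : ∀ i, N.Label (S i), ∫⁻ x, f x ∂N.pathLaw L ≤ ∫⁻ x, g x ∂N.pathLaw L) :
    ∫⁻ x, f x ∂N.mixturePathLaw S ≤ ∫⁻ x, g x ∂N.mixturePathLaw S :=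
  lintegral_infinitePi_mixture_le (α := fun i => N.Label (S i)) (fun _ σ => N.sampleLaw σ)
    (P := fun i => N.mixtureLaw (S i)) (fun _ => rfl) hf hg h

/-- Symmetric functions of the data vector have the same law under all labels. -/
lemma lintegral_sampleLaw_eq {s : Option (Fin K)} (σ : N.Label s) {f : (Fin n → X) → ℝ≥0∞}
    (hf : Measurable f) (hsymm : ∀ (e : Equiv.Perm (Fin n)) x, f (fun i => x (e i)) = f x) :
    ∫⁻ x, f x ∂N.sampleLaw σ = ∫⁻ x, f x ∂N.mixtureLaw s := by
  -- Two labels of the same state differ by a permutation of the sensors, which carries one product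
  -- law to the other and leaves `f` unchanged.
  have key : ∀ σ' : N.Label s, ∫⁻ x, f x ∂N.sampleLaw σ' = ∫⁻ x, f x ∂N.sampleLaw σ := by
    intro σ'
    obtain ⟨e, he⟩ := σ.exists_perm σ'
    have h := measurePreserving_piCongrLeft (α := fun _ : Fin n => X)
      (fun i => μ.withDensity fun x => (N.groupDensity (σ'.1 i) x : ℝ≥0∞)) e
    simp_rw [he] at h
    change MeasurePreserving _ (N.sampleLaw σ) (N.sampleLaw σ') at h
    rw [← h.lintegral_comp hf]
    refine lintegral_congr fun x => ?_
    rw [← hsymm e]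
    congr 1 with i
    exact MeasurableEquiv.piCongrLeft_apply_apply (β := fun _ => X) e x i
  simp only [mixtureLaw, lintegral_smul_measure, lintegral_finsetSum_measure, key,
    Finset.sum_const, Finset.card_univ, nsmul_eq_mul, smul_eq_mul]
  rw [← mul_assoc, ENNReal.inv_mul_cancel (by simp [Fintype.card_ne_zero]) (by simp), one_mul]

lemma sampleLaw_eq_withDensity [SigmaFinite μ] {s : Option (Fin K)} (σ : N.Label s) :
    N.sampleLaw σ = (Measure.pi fun _ => μ).withDensity
      fun x => ∏ i, (N.groupDensity (σ.1 i) (x i) : ℝ≥0∞) := by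
  refine Measure.pi_eq fun A hA => ?_
  rw [withDensity_apply _ (.univ_pi hA), ← lintegral_indicator (.univ_pi hA)]
  have e : ∀ x : Fin n → X, (Set.univ.pi A).indicator
      (fun x => ∏ i, (N.groupDensity (σ.1 i) (x i) : ℝ≥0∞)) x =
      ∏ i, (A i).indicator (fun y => (N.groupDensity (σ.1 i) y : ℝ≥0∞)) (x i) := by
    intro x
    by_cases hx : x ∈ Set.univ.pi A
    · rw [Set.indicator_of_mem hx]
      exact Finset.prod_congr rfl fun i hi => by rw [Set.indicator_of_mem (hx i trivial)]
    · rw [Set.indicator_of_notMem hx]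
      simp only [Set.mem_pi, Set.mem_univ, forall_const, not_forall] at hx
      obtain ⟨i, hx⟩ := hx
      rw [Finset.prod_eq_zero (Finset.mem_univ i) (Set.indicator_of_notMem hx _)]
  simp_rw [e]
  rw [lintegral_pi_prod fun i =>
    (N.measurable_groupDensity (σ.1 i)).coe_nnreal_ennreal.indicator (hA i)]
  refine Finset.prod_congr rfl fun i _ => ?_
  rw [lintegral_indicator (hA i), withDensity_apply _ (hA i)]

lemma mixtureLaw_eq_withDensity [SigmaFinite μ] (s : Option (Fin K)) :
    N.mixtureLaw s = (Measure.pi fun _ => μ).withDensity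
      fun x => (N.mixtureDensity s x : ℝ≥0∞) := by
  ext A hA
  rw [withDensity_apply _ hA]
  simp only [mixtureLaw, sampleLaw_eq_withDensity, Measure.smul_apply, Measure.finsetSum_apply,
    withDensity_apply _ hA, mixtureDensity]
  push_cast
  have hm : ∀ σ : N.Label s, Measurable fun x : Fin n → X =>
      ∏ i, (N.groupDensity (σ.1 i) (x i) : ℝ≥0∞) := fun σ =>
    Finset.measurable_prod _ fun i _ =>
      ((N.measurable_groupDensity _).comp (measurable_pi_apply i)).coe_nnreal_ennreal
  rw [← lintegral_finsetSum _ fun σ _ => hm σ, smul_eq_mul,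
    ← lintegral_const_mul _ (Finset.measurable_sum _ fun σ _ => hm σ)]

end SensorNetwork

/-! ### Delays as sums over the times of not having stopped. -/

/-- Subtraction in `ℝ≥0∞` is the positive part. The series form, valid also for an infinite stopping
time, reduces means of delays to probabilities of survival events. -/
lemma toENNReal_sub_eq_tsum (m : WithTop ℕ) (ν : ℕ) :
    ENat.toENNReal m - (ν : ℝ≥0∞) =
      ∑' s : ℕ, if ((ν + s : ℕ) : WithTop ℕ) < m then (1 : ℝ≥0∞) else 0 := by
  induction m using WithTop.recTopCoe with
  | top =>
    have h : ∀ s : ℕ, ((ν + s : ℕ) : WithTop ℕ) < ⊤ := fun s => WithTop.coe_lt_top _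
    simp only [h, if_true]
    rw [ENNReal.tsum_const_eq_top_of_ne_zero one_ne_zero]
    exact ENNReal.top_sub (ENNReal.natCast_ne_top ν)
  | coe m =>
    rw [tsum_eq_sum (s := Finset.range (m - ν))]
    · rw [Finset.sum_congr rfl (g := fun _ => (1 : ℝ≥0∞))]
      · simp only [Finset.sum_const, Finset.card_range, nsmul_eq_mul, mul_one]
        exact (ENNReal.natCast_sub m ν).symm
      · intro s hs
        rw [if_pos]
        have := Finset.mem_range.1 hs
        exact (Nat.cast_lt (α := WithTop ℕ)).2 (by omega : ν + s < m)
    · intro s hs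
      rw [if_neg]
      have := mt Finset.mem_range.2 hs
      exact mt (Nat.cast_lt (α := WithTop ℕ)).1 (by omega : ¬ ν + s < m)

variable {Ω : Type*} {mΩ : MeasurableSpace Ω}

lemma measurableSet_coe_lt {τ : Ω → WithTop ℕ} (hτ : ∀ t : ℕ, MeasurableSet {x | τ x ≤ t})
    (t : ℕ) : MeasurableSet {x | (t : WithTop ℕ) < τ x} := by
  convert (hτ t).compl using 1
  ext x; simp

lemma toENNReal_sub_eq_tsum_indicator (τ : Ω → WithTop ℕ) (ν : ℕ) (x : Ω) :
    ENat.toENNReal (τ x) - (ν : ℝ≥0∞) =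
      ∑' s : ℕ, {x | ((ν + s : ℕ) : WithTop ℕ) < τ x}.indicator 1 x := by
  rw [toENNReal_sub_eq_tsum]
  simp only [Set.indicator, Set.mem_ofPred_eq, Pi.one_apply]

lemma measurable_toENNReal_sub {τ : Ω → WithTop ℕ} (hτ : ∀ t : ℕ, MeasurableSet {x | τ x ≤ t})
    (ν : ℕ) : Measurable fun x => ENat.toENNReal (τ x) - (ν : ℝ≥0∞) := by
  simp_rw [toENNReal_sub_eq_tsum_indicator]
  exact Measurable.tsum fun s => measurable_one.indicator (measurableSet_coe_lt hτ _)

lemma lintegral_toENNReal_eq_tsum {τ : Ω → WithTop ℕ}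
    (hτ : ∀ t : ℕ, MeasurableSet {x | τ x ≤ t}) (P : Measure Ω) :
    ∫⁻ x, ENat.toENNReal (τ x) ∂P = ∑' s : ℕ, P {x | (s : WithTop ℕ) < τ x} := by
  have h := fun x => toENNReal_sub_eq_tsum_indicator τ 0 x
  simp only [Nat.cast_zero, tsub_zero, zero_add] at h
  simp_rw [h]
  rw [lintegral_tsum fun s =>
    (measurable_one.indicator (measurableSet_coe_lt hτ s)).aemeasurable]
  refine tsum_congr fun s => ?_
  exact lintegral_indicator_one (measurableSet_coe_lt hτ s)

/-! ### The false alarm bound through Shiryaev–Roberts statistics. -/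

namespace SensorNetwork

variable {X : Type*} [MeasurableSpace X] {μ : Measure X} {K n : ℕ} (N : SensorNetwork μ K n)

/-- The likelihood ratio of the mixtures. -/
def mixtureLR (k : Fin K) (y : Fin n → X) : ℝ≥0∞ :=
  (N.mixtureDensity (some k) y : ℝ≥0∞) / (N.mixtureDensity none y : ℝ≥0∞)

lemma measurable_mixtureLR (k : Fin K) : Measurable (N.mixtureLR k) :=
  (N.measurable_mixtureDensity _).coe_nnreal_ennreal.div
    (N.measurable_mixtureDensity _).coe_nnreal_ennreal

lemma mixtureLLR_eq_log (k : Fin K) (y : Fin n → X) :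
    N.mixtureLLR k y = ENNReal.log (N.mixtureLR k y) := rfl

lemma mixtureLR_comp_perm (k : Fin K) (e : Equiv.Perm (Fin n)) (x : Fin n → X) :
    N.mixtureLR k (fun i => x (e i)) = N.mixtureLR k x := by
  simp only [mixtureLR, mixtureDensity_comp_perm]

lemma lintegral_mixtureLaw [SigmaFinite μ] (s : Option (Fin K)) {f : (Fin n → X) → ℝ≥0∞}
    (hf : Measurable f) : ∫⁻ y, f y ∂N.mixtureLaw s =
      ∫⁻ y, N.mixtureDensity s y * f y ∂Measure.pi fun _ => μ := by
  rw [mixtureLaw_eq_withDensity, lintegral_withDensity_eq_lintegral_mul _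
    (N.measurable_mixtureDensity s).coe_nnreal_ennreal hf]
  rfl

lemma lintegral_mixtureDensity [SigmaFinite μ] (s : Option (Fin K)) :
    ∫⁻ y, N.mixtureDensity s y ∂Measure.pi (fun _ => μ) = 1 := by
  have := N.lintegral_mixtureLaw s (f := 1) measurable_one
  simpa using this.symm

/-- Equality can fail: the post-change mixture may charge the set where the pre-change density
vanishes. The inequality is enough for a supermartingale. -/
lemma lintegral_mixtureLR_le_one [SigmaFinite μ] (k : Fin K) :
    ∫⁻ y, N.mixtureLR k y ∂N.mixtureLaw none ≤ 1 := by
  rw [lintegral_mixtureLaw _ _ (N.measurable_mixtureLR k), ← N.lintegral_mixtureDensity (some k)]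
  exact lintegral_mono fun y => ENNReal.mul_div_le

lemma sum_mixtureLLR_eq_log (k : Fin K) (s : Finset ℕ) (x : ℕ → Fin n → X) :
    ∑ i ∈ s, N.mixtureLLR k (x i) = ENNReal.log (∏ i ∈ s, N.mixtureLR k (x i)) := by
  classical
  induction s using Finset.induction_on with
  | empty => simp
  | insert i s hi ih => rw [Finset.sum_insert hi, Finset.prod_insert hi, ENNReal.log_mul_add, ih,
      mixtureLLR_eq_log]

/-- The Shiryaev–Roberts statistic of the mixtures for type `k`. -/
def shiryaevRoberts (k : Fin K) : ℕ → (ℕ → Fin n → X) → ℝ≥0∞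
  | 0, _ => 0
  | t + 1, x => (shiryaevRoberts k t x + 1) * N.mixtureLR k (x t)

lemma measurable_shiryaevRoberts (k : Fin K) (t : ℕ) :
    Measurable[history (Fin n → X) t] (N.shiryaevRoberts k t) := by
  induction t with
  | zero => exact measurable_const
  | succ t ih =>
    exact ((ih.mono (history_mono t.le_succ) le_rfl).add_const 1).mul
      ((N.measurable_mixtureLR k).comp (measurable_eval_history t.lt_succ_self))

/-- Unrolled, the recursion is the sum of these products over all starting points `j < t`. -/
lemma prod_mixtureLR_le_shiryaevRoberts (k : Fin K) {j t : ℕ} (h : j < t)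
    (x : ℕ → Fin n → X) :
    ∏ i ∈ Finset.Ico j t, N.mixtureLR k (x i) ≤ N.shiryaevRoberts k t x := by
  induction t with
  | zero => omega
  | succ t ih =>
    rw [Finset.prod_Ico_succ_top (by omega), shiryaevRoberts]
    gcongr
    rcases Nat.lt_succ_iff_lt_or_eq.1 h with h | rfl
    · exact (ih h).trans le_self_add
    · simp

lemma statistic_le_log (t : ℕ) (x : ℕ → Fin n → X) :
    N.statistic t x ≤ ENNReal.log (∑ k, N.shiryaevRoberts k t x) := by
  refine iSup_le fun k => iSup_le fun j => ?_
  rw [sum_mixtureLLR_eq_log]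
  refine ENNReal.log_monotone ((N.prod_mixtureLR_le_shiryaevRoberts k j.2 x).trans ?_)
  exact Finset.single_le_sum (f := fun k => N.shiryaevRoberts k t x) (fun _ _ => zero_le)
    (Finset.mem_univ k)

lemma measurable_statistic (t : ℕ) : Measurable[history (Fin n → X) t] (N.statistic t) := by
  unfold statistic
  refine Measurable.iSup fun k => Measurable.iSup fun j => ?_
  simp_rw [sum_mixtureLLR_eq_log]
  refine ENNReal.measurable_log.comp (Finset.measurable_prod _ fun i hi => ?_)
  exact (N.measurable_mixtureLR k).comp (measurable_eval_history (Finset.mem_Ico.1 hi).2)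

lemma isStoppingTime_gmCuSum (b : ℝ) :
    IsStoppingTime (sampleFiltration (Fin n → X)) (N.gmCuSum b) :=
  Adapted.isStoppingTime_hittingAfter (fun t => N.measurable_statistic t) measurableSet_Ici

end SensorNetwork

lemma IsStoppingTime.measurableSet_history_lt {Y : Type*} [MeasurableSpace Y]
    {τ : (ℕ → Y) → WithTop ℕ} (hτ : IsStoppingTime (sampleFiltration Y) τ) (t : ℕ) :
    MeasurableSet[history Y t] {x | (t : WithTop ℕ) < τ x} := by
  have h : {x | (t : WithTop ℕ) < τ x} = {x | τ x ≤ t}ᶜ := by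
    ext x; simp
  rw [h]
  exact (hτ t).compl

lemma IsStoppingTime.measurableSet_pi_le {Y : Type*} [MeasurableSpace Y]
    {τ : (ℕ → Y) → WithTop ℕ} (hτ : IsStoppingTime (sampleFiltration Y) τ) (t : ℕ) :
    MeasurableSet {x | τ x ≤ t} :=
  history_le_pi t _ (hτ t)

namespace SensorNetwork

variable {X : Type*} [MeasurableSpace X] {μ : Measure X} [SigmaFinite μ] {K n : ℕ}
  (N : SensorNetwork μ K n)

/-- Optional stopping at `min T t` for the supermartingale `∑ k, R_k(t) - K t`, arranged without
subtraction. The right side is `K E[min T t]`; on the left, the value at `T` has been replaced by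
its lower bound `K γ`. -/
lemma lintegral_shiryaevRoberts_add_le {γ : ℝ} (hγ : 0 < γ) (hK : 0 < K)
    (L : ∀ i, N.Label (noAnomaly K i)) (t : ℕ) :
    ∫⁻ x, {x | (t : WithTop ℕ) < N.gmCuSum (Real.log (K * γ)) x}.indicator
        (fun x => ∑ k, N.shiryaevRoberts k t x) x ∂N.pathLaw L +
      ENNReal.ofReal (K * γ) * N.pathLaw L {x | N.gmCuSum (Real.log (K * γ)) x ≤ t} ≤
    K * ∑ s ∈ Finset.range t,
      N.pathLaw L {x | (s : WithTop ℕ) < N.gmCuSum (Real.log (K * γ)) x} := by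
  set T := N.gmCuSum (Real.log (K * γ)) with hT
  have hst : IsStoppingTime (sampleFiltration (Fin n → X)) T := N.isStoppingTime_gmCuSum _
  set P := N.pathLaw L with hP
  have hKγ : 0 < K * γ := by positivity
  have hSR : ∀ t, Measurable fun x : ℕ → Fin n → X => ∑ k, N.shiryaevRoberts k t x := fun t =>
    Finset.measurable_sum _ fun k _ =>
      (N.measurable_shiryaevRoberts k t).mono (history_le_pi t) le_rfl
  have hlt : ∀ t : ℕ, MeasurableSet {x | (t : WithTop ℕ) < T x} :=
    fun t => measurableSet_coe_lt (IsStoppingTime.measurableSet_pi_le hst) t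
  induction t with
  | zero =>
    have h0 : {x | T x ≤ (0 : ℕ)} = ∅ := by
      ext x
      simp only [hT, gmCuSum, Set.mem_ofPred_eq, Set.mem_empty_iff_false, iff_false]
      intro h
      have := (le_hittingAfter (u := N.statistic) (s := Set.Ici ((Real.log (K * γ) : ℝ) : EReal))
        (n := 1) x).trans h
      exact absurd (WithTop.coe_le_coe.1 this) (by norm_num)
    rw [h0]
    simp [shiryaevRoberts]
  | succ t ih =>
    -- Given the history, the new likelihood ratio has mean at most 1 under any label, so each of
    -- the `K` statistics grows by at most 1 in mean on survival.
    have hstep : ∫⁻ x, {x | (t : WithTop ℕ) < T x}.indicator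
          (fun x => ∑ k, N.shiryaevRoberts k (t + 1) x) x ∂P ≤
        ∫⁻ x, {x | (t : WithTop ℕ) < T x}.indicator
          (fun x => ∑ k, N.shiryaevRoberts k t x) x ∂P + K * P {x | (t : WithTop ℕ) < T x} := by
      have e1 : ∀ x, {x | (t : WithTop ℕ) < T x}.indicator
          (fun x => ∑ k, N.shiryaevRoberts k (t + 1) x) x =
          ∑ k, {x | (t : WithTop ℕ) < T x}.indicator (fun x => N.shiryaevRoberts k t x + 1) x *
            N.mixtureLR k (x t) := by
        intro x
        by_cases hx : x ∈ {x | (t : WithTop ℕ) < T x}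
        · simp only [Set.indicator_of_mem hx, shiryaevRoberts]
        · simp only [Set.indicator_of_notMem hx, zero_mul, Finset.sum_const_zero]
      have hmk : ∀ k, Measurable[history (Fin n → X) t] ({x | (t : WithTop ℕ) < T x}.indicator
          (fun x => N.shiryaevRoberts k t x + 1)) := fun k =>
        ((N.measurable_shiryaevRoberts k t).add_const 1).indicator
          (IsStoppingTime.measurableSet_history_lt hst t)
      have hmk' := fun k => (hmk k).mono (history_le_pi t) le_rfl
      simp_rw [e1]
      have hmL : ∀ k, Measurable fun x : ℕ → Fin n → X => N.mixtureLR k (x t) := fun k =>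
        (N.measurable_mixtureLR k).comp (measurable_pi_apply t)
      rw [lintegral_finsetSum _ fun k _ => (hmk' k).fun_mul (hmL k)]
      calc _ ≤ ∑ k, ∫⁻ x, {x | (t : WithTop ℕ) < T x}.indicator
            (fun x => N.shiryaevRoberts k t x + 1) x ∂P := by
            refine Finset.sum_le_sum fun k _ => ?_
            rw [hP, pathLaw, lintegral_infinitePi_mul_eval _ t (hmk k) (N.measurable_mixtureLR k),
              N.lintegral_sampleLaw_eq (L t) (N.measurable_mixtureLR k)
                (N.mixtureLR_comp_perm k)]
            exact mul_le_of_le_one_right' (N.lintegral_mixtureLR_le_one k)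
        _ = ∫⁻ x, {x | (t : WithTop ℕ) < T x}.indicator
              (fun x => ∑ k, N.shiryaevRoberts k t x) x +
              K * {x | (t : WithTop ℕ) < T x}.indicator 1 x ∂P := by
            rw [← lintegral_finsetSum _ fun k _ => hmk' k]
            refine lintegral_congr fun x => ?_
            by_cases hx : x ∈ {x | (t : WithTop ℕ) < T x}
            · simp only [Set.indicator_of_mem hx, Finset.sum_add_distrib]
              simp
            · simp only [Set.indicator_of_notMem hx]
              simp
        _ = _ := by
            rw [lintegral_add_left ((hSR t).indicator (hlt t)), lintegral_const_mul _
              (measurable_one.indicator (hlt t)), lintegral_indicator_one (hlt t)]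
    -- The paths that stop exactly at `t + 1` pass from the first term to the second: there the sum
    -- of the statistics is at least `K γ`.
    have hsplit : ∫⁻ x, {x | ((t + 1 : ℕ) : WithTop ℕ) < T x}.indicator
          (fun x => ∑ k, N.shiryaevRoberts k (t + 1) x) x ∂P +
        ENNReal.ofReal (K * γ) * P {x | T x ≤ (t + 1 : ℕ)} ≤
        ∫⁻ x, {x | (t : WithTop ℕ) < T x}.indicator
          (fun x => ∑ k, N.shiryaevRoberts k (t + 1) x) x ∂P +
        ENNReal.ofReal (K * γ) * P {x | T x ≤ t} := by
      have hle := IsStoppingTime.measurableSet_pi_le hst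
      rw [← lintegral_indicator_one (hle _), ← lintegral_indicator_one (hle t),
        ← lintegral_const_mul _ (measurable_one.indicator (hle _)),
        ← lintegral_const_mul _ (measurable_one.indicator (hle _)),
        ← lintegral_add_left ((hSR _).indicator (hlt _)),
        ← lintegral_add_left ((hSR _).indicator (hlt _))]
      refine lintegral_mono fun x => ?_
      simp only [Set.indicator, Set.mem_ofPred_eq, Pi.one_apply]
      rcases lt_or_ge ((t + 1 : ℕ) : WithTop ℕ) (T x) with h1 | h1
      · have h2 : (t : WithTop ℕ) < T x := lt_trans (Nat.cast_lt.2 t.lt_succ_self) h1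
        rw [if_pos h1, if_pos h2, if_neg (not_le.2 h1), if_neg (not_le.2 h2)]
      · rcases le_or_gt (T x) (t : WithTop ℕ) with h2 | h2
        · rw [if_neg (not_lt.2 h1), if_neg (not_lt.2 h2), if_pos h1, if_pos h2]
        · have h3 : T x = ((t + 1 : ℕ) : WithTop ℕ) := by
            refine le_antisymm h1 ?_
            revert h2
            induction T x using WithTop.recTopCoe with
            | top => simp
            | coe m => intro h2; exact Nat.cast_le.2 (Nat.cast_lt (α := WithTop ℕ).1 h2)
          have h4 : ENNReal.ofReal (K * γ) ≤ ∑ k, N.shiryaevRoberts k (t + 1) x := by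
            have hmem := hittingAfter_mem_set_of_ne_top (u := N.statistic)
              (s := Set.Ici ((Real.log (K * γ) : ℝ) : EReal)) (n := 1) (ω := x)
              (by change T x ≠ ⊤; rw [h3]; exact WithTop.coe_ne_top)
            change N.statistic (T x).untopA x ∈ _ at hmem
            rw [h3, show ((t + 1 : ℕ) : WithTop ℕ).untopA = t + 1 from WithTop.untopD_coe _ _] at hmem
            rw [← ENNReal.log_le_log_iff, ENNReal.log_ofReal_of_pos hKγ]
            exact le_trans hmem (N.statistic_le_log _ x)
          rw [if_neg (not_lt.2 h1), if_pos h2, if_pos h1, if_neg (not_le.2 h2)]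
          simpa using h4
    calc _ ≤ _ := hsplit
      _ ≤ _ := add_le_add_left hstep _
      _ = (∫⁻ x, {x | (t : WithTop ℕ) < T x}.indicator
          (fun x => ∑ k, N.shiryaevRoberts k t x) x ∂P +
          ENNReal.ofReal (K * γ) * P {x | T x ≤ t}) + K * P {x | (t : WithTop ℕ) < T x} := by
          rw [add_right_comm]
      _ ≤ _ := by
          rw [Finset.sum_range_succ, mul_add]
          exact add_le_add_left ih _

/-- The GM-CuSum time with threshold `log (K γ)` meets the false alarm constraint. -/
lemma le_WARL_gmCuSum {γ : ℝ} (hγ : 0 < γ) (hK : 0 < K) :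
    ENNReal.ofReal γ ≤ N.WARL (N.gmCuSum (Real.log (K * γ))) := by
  refine le_iInf fun L => ?_
  set T := N.gmCuSum (Real.log (K * γ)) with hT
  have hle := IsStoppingTime.measurableSet_pi_le (N.isStoppingTime_gmCuSum (Real.log (K * γ)))
  rw [lintegral_toENNReal_eq_tsum hle]
  set E := ∑' s : ℕ, N.pathLaw L {x | (s : WithTop ℕ) < T x} with hE
  -- A finite mean forces `P(T ≤ t) → 1`, and then `K γ P(T ≤ t) ≤ K E` gives the claim in the
  -- limit.
  by_cases hfin : E = ∞
  · rw [hfin]; exact le_top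
  have hbound : ∀ t : ℕ, ENNReal.ofReal (K * γ) * N.pathLaw L {x | T x ≤ t} ≤ K * E := fun t =>
    (le_add_self.trans (N.lintegral_shiryaevRoberts_add_le hγ hK L t)).trans
      (mul_le_mul_right (ENNReal.sum_le_tsum _) _)
  have hlim : Tendsto (fun t : ℕ => N.pathLaw L {x | T x ≤ t}) atTop (nhds 1) := by
    have h0 := ENNReal.tendsto_atTop_zero_of_tsum_ne_top hfin
    have h1 := ENNReal.Tendsto.sub (tendsto_const_nhds (x := (1 : ℝ≥0∞))) h0 (by simp)
    rw [tsub_zero] at h1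
    refine h1.congr fun t => ?_
    rw [← prob_compl_eq_one_sub (measurableSet_coe_lt hle t)]
    congr 1
    ext x; simp [hT]
  have h2 := ENNReal.Tendsto.const_mul hlim (a := ENNReal.ofReal (K * γ)) (by simp)
  have h3 := le_of_tendsto' h2 hbound
  rw [mul_one, ENNReal.ofReal_mul (by positivity), ENNReal.ofReal_natCast] at h3
  exact (ENNReal.mul_le_mul_iff_right (by simp [hK.ne']) (by simp)).1 h3

end SensorNetwork

/-! ### A Lyapunov function for the first passage of a random walk. -/

section Overshoot

/-- The primitive of `u ↦ (p - u)⁺` on `[0, ∞)`, continued linearly to the negative numbers. -/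
def excessPrimitive (p y : ℝ) : ℝ :=
  if 0 ≤ y then ((max p 0) ^ 2 - (max (p - y) 0) ^ 2) / 2 else y * max p 0

/-- The tangent inequality of a concave function: the slope is `(p - y)⁺` for `y ≥ 0` and the
constant `p⁺` for `y < 0`, hence nonincreasing. -/
lemma excessPrimitive_sub_le (p w : ℝ) {x : ℝ} (hx : 0 ≤ x) :
    excessPrimitive p (x - w) ≤ excessPrimitive p x - w * max (p - x) 0 := by
  have hconv : ∀ s t : ℝ, (max s 0) ^ 2 + 2 * (t - s) * max s 0 ≤ (max t 0) ^ 2 := by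
    intro s t
    rcases max_cases s 0 with ⟨h1, h2⟩ | ⟨h1, h2⟩ <;>
    rcases max_cases t 0 with ⟨h3, h4⟩ | ⟨h3, h4⟩ <;> rw [h1, h3] <;>
    nlinarith [sq_nonneg (t - s), sq_nonneg t]
  unfold excessPrimitive
  rw [if_pos hx]
  split_ifs with h
  · have := hconv (p - x) (p - (x - w))
    nlinarith
  · have h1 := hconv (p - x) p
    have h2 : max (p - x) 0 ≤ max p 0 := max_le_max (by linarith) le_rfl
    nlinarith

lemma excessPrimitive_nonneg (p : ℝ) {y : ℝ} (hy : 0 ≤ y) : 0 ≤ excessPrimitive p y := by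
  unfold excessPrimitive
  rw [if_pos hy]
  have h2 : max (p - y) 0 ≤ max p 0 := max_le_max (by linarith) le_rfl
  have h3 : 0 ≤ max (p - y) 0 := le_max_right _ _
  nlinarith

lemma excessPrimitive_le (p : ℝ) {y : ℝ} (hy : 0 ≤ y) :
    excessPrimitive p y ≤ (max p 0) ^ 2 / 2 := by
  unfold excessPrimitive
  rw [if_pos hy]
  have := sq_nonneg (max (p - y) 0)
  linarith

variable {Ω : Type*} [MeasurableSpace Ω] {P : Measure Ω} [IsProbabilityMeasure P]

lemma tendsto_integral_excess {Z : Ω → ℝ} (hZ : Integrable Z P) :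
    Tendsto (fun a : ℕ => ∫ ω, max (Z ω - a) 0 ∂P) atTop (nhds 0) := by
  have h := tendsto_integral_of_dominated_convergence (μ := P) (F := fun (a : ℕ) ω => max (Z ω - a) 0)
    (f := fun _ => 0) (fun ω => |Z ω|)
    (fun a => (hZ.sub (integrable_const _)).pos_part.aestronglyMeasurable) hZ.abs
    (fun a => Eventually.of_forall fun ω => ?_) (Eventually.of_forall fun ω => ?_)
  · simpa using h
  · have ha : (0 : ℝ) ≤ a := a.cast_nonneg
    rw [Real.norm_eq_abs, abs_of_nonneg (le_max_right _ _)]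
    exact max_le ((sub_le_self _ ha).trans (le_abs_self _)) (abs_nonneg _)
  · obtain ⟨a, ha⟩ := exists_nat_ge (Z ω)
    refine tendsto_const_nhds.congr' ?_
    filter_upwards [eventually_ge_atTop a] with b hb
    have : (a : ℝ) ≤ b := by exact_mod_cast hb
    exact (max_eq_right (by linarith)).symm

/-- A Lyapunov function for the first passage of a random walk with increments `Z` over a level at
distance `x`. It shows that the mean of the passage time is at most `x / E Z + O(1)`. -/
theorem exists_passage_lyapunov {Z : Ω → ℝ} (hZ : Integrable Z P) (hI : 0 < ∫ ω, Z ω ∂P)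
    (hZ2 : Integrable (fun ω => (max (Z ω) 0) ^ 2) P) :
    ∃ V : ℝ → ℝ, ∃ C : ℝ, Measurable V ∧ 0 ≤ C ∧
      (∀ x, 0 < x → V x ≤ x / (∫ ω, Z ω ∂P) + C) ∧
      ∀ x, 0 < x → ∫⁻ ω, ENNReal.ofReal (V (x - Z ω)) ∂P + 1 ≤ ENNReal.ofReal (V x) := by
  set I := ∫ ω, Z ω ∂P with hIdef
  -- This choice of `a` makes the slope of `g` on the negative half-line at most 1, so that `g y ≥
  -- y` there.
  obtain ⟨a, ha⟩ : ∃ a : ℕ, ∫ ω, max (Z ω - a) 0 ∂P ≤ I / 2 :=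
    ((tendsto_integral_excess hZ).eventually (ge_mem_nhds (by positivity))).exists
  have ha0 : (0 : ℝ) ≤ a := a.cast_nonneg
  set h : ℝ → ℝ := fun u => ∫ ω, max (Z ω - a - u) 0 ∂P with hh
  have hint : ∀ u, Integrable (fun ω => max (Z ω - a - u) 0) P := fun u =>
    ((hZ.sub (integrable_const _)).sub (integrable_const u)).pos_part
  have hnn : ∀ u, 0 ≤ h u := fun u => integral_nonneg fun ω => le_max_right _ _
  have hsq : ∀ u, 0 ≤ u → Integrable (fun ω => (max (Z ω - a - u) 0) ^ 2) P := by
    intro u hu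
    refine hZ2.mono' ((hint u).aestronglyMeasurable.pow 2) (Eventually.of_forall fun ω => ?_)
    rw [Real.norm_eq_abs, abs_of_nonneg (sq_nonneg _)]
    exact pow_le_pow_left₀ (le_max_right _ _) (max_le_max (by linarith) le_rfl) 2
  have hq : ∀ y, Integrable (fun ω => excessPrimitive (Z ω - a) y) P := by
    intro y
    unfold excessPrimitive
    split_ifs with hy
    · have h0 := hsq 0 le_rfl
      simp only [sub_zero] at h0
      exact (h0.sub (hsq y hy)).div_const 2
    · have h0 := hint 0
      simp only [sub_zero] at h0
      exact h0.const_mul y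
  -- `g` is concave with slope `2 h / I` on `[0, ∞)`, so a step of mean `I` lowers it by at least `2
  -- h x` in mean. This pays for the overshoot, and the second moment keeps `g` bounded on `[0, ∞)`.
  set g : ℝ → ℝ := fun y => 2 / I * ∫ ω, excessPrimitive (Z ω - a) y ∂P with hg
  have hgsub : ∀ x w, 0 ≤ x → g (x - w) ≤ g x - w * (2 / I * h x) := by
    intro x w hx
    have h1 : ∫ ω, excessPrimitive (Z ω - a) (x - w) ∂P ≤
        ∫ ω, (excessPrimitive (Z ω - a) x - w * max (Z ω - a - x) 0) ∂P :=
      integral_mono (hq _) ((hq x).sub ((hint x).const_mul w)) fun ω =>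
        excessPrimitive_sub_le _ _ hx
    rw [integral_sub (hq x) ((hint x).const_mul w), integral_const_mul] at h1
    calc g (x - w) ≤ 2 / I * (∫ ω, excessPrimitive (Z ω - a) x ∂P - w * h x) :=
          mul_le_mul_of_nonneg_left h1 (by positivity)
      _ = _ := by simp only [hg]; ring
  have hgnn : ∀ y, 0 ≤ y → 0 ≤ g y := fun y hy =>
    mul_nonneg (by positivity) (integral_nonneg fun ω => excessPrimitive_nonneg _ hy)
  have hgle : ∀ y, 0 ≤ y → g y ≤ 2 / I * ∫ ω, (max (Z ω) 0) ^ 2 / 2 ∂P := by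
    intro y hy
    refine mul_le_mul_of_nonneg_left (integral_mono (hq y) (hZ2.div_const 2) fun ω => ?_)
      (by positivity)
    refine (excessPrimitive_le _ hy).trans ?_
    have h1 : max (Z ω - a) 0 ≤ max (Z ω) 0 := max_le_max (by linarith) le_rfl
    have h2 : 0 ≤ max (Z ω - a) 0 := le_max_right _ _
    change _ ≤ (max (Z ω) 0) ^ 2 / 2
    nlinarith
  have hgneg : ∀ y, y ≤ 0 → y ≤ g y := by
    intro y hy
    rcases hy.lt_or_eq with hy | rfl
    · have h1 : g y = y * (2 / I * ∫ ω, max (Z ω - a) 0 ∂P) := by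
        simp only [hg, excessPrimitive, if_neg (not_le.2 hy), integral_const_mul]
        ring
      have h2 : 2 / I * ∫ ω, max (Z ω - a) 0 ∂P ≤ 1 := by
        calc _ ≤ 2 / I * (I / 2) := mul_le_mul_of_nonneg_left ha (by positivity)
          _ = 1 := by field_simp
      rw [h1]
      nlinarith
    · exact hgnn 0 le_rfl
  set V : ℝ → ℝ := fun x => if 0 < x then (x + 2 * a + g x) / I else 0 with hV
  have hVnn : ∀ x, 0 ≤ V x := by
    intro x
    simp only [hV]
    split_ifs with hx
    · have := hgnn x hx.le
      positivity
    · exact le_rfl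
  have hVmono : Monotone V := by
    intro x y hxy
    simp only [hV]
    split_ifs with hx hy hy
    · have h1 := hgsub y (y - x) hy.le
      rw [sub_sub_cancel] at h1
      have h2 : 0 ≤ (y - x) * (2 / I * h y) :=
        mul_nonneg (by linarith) (mul_nonneg (by positivity) (hnn y))
      gcongr
      linarith
    · exact absurd (hx.trans_le hxy) hy
    · have := hgnn y hy.le
      positivity
    · exact le_rfl
  refine ⟨V, (2 * a + 2 / I * ∫ ω, (max (Z ω) 0) ^ 2 / 2 ∂P) / I, hVmono.measurable, ?_, ?_, ?_⟩
  · have : 0 ≤ ∫ ω, (max (Z ω) 0) ^ 2 / 2 ∂P := integral_nonneg fun ω => by positivity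
    positivity
  · intro x hx
    simp only [hV, if_pos hx]
    rw [← add_div]
    have := hgle x hx.le
    exact (div_le_div_iff_of_pos_right hI).2 (by linarith)
  · intro x hx
    -- `U` linearizes `V` at `x`. The term `2 (Z - a - x)⁺` keeps `U` nonnegative after a passage,
    -- where `V` vanishes; its mean `2 h x` cancels the gain from `g`, leaving a drift of exactly
    -- `-1`.
    set U : Ω → ℝ := fun ω =>
      (x + 2 * a + g x - Z ω * (1 + 2 / I * h x) + 2 * max (Z ω - a - x) 0) / I with hU
    have hVU : ∀ ω, V (x - Z ω) ≤ U ω := by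
      intro ω
      have h1 := hgsub x (Z ω) hx.le
      have h2 : 0 ≤ max (Z ω - a - x) 0 := le_max_right _ _
      have h3 : Z ω - a - x ≤ max (Z ω - a - x) 0 := le_max_left _ _
      simp only [hV, hU]
      split_ifs with hy
      · exact (div_le_div_iff_of_pos_right hI).2 (by linarith)
      · refine div_nonneg ?_ hI.le
        have h4 := hgneg (x - Z ω) (not_lt.1 hy)
        linarith
    have i1 : Integrable (fun ω => x + 2 * a + g x - Z ω * (1 + 2 / I * h x)) P :=
      (integrable_const _).sub (hZ.mul_const _)
    have i2 : Integrable (fun ω => 2 * max (Z ω - a - x) 0) P := (hint x).const_mul 2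
    have hUint : Integrable U P := (i1.add i2).div_const I
    have hUval : ∫ ω, U ω ∂P = V x - 1 := by
      simp only [hU]
      rw [integral_div, integral_add i1 i2, integral_sub (integrable_const _) (hZ.mul_const _),
        integral_mul_const, integral_const_mul]
      simp only [integral_const, probReal_univ, one_smul, hV, if_pos hx]
      change (x + 2 * a + g x - I * (1 + 2 / I * h x) + 2 * h x) / I = _
      field_simp
      ring
    have hUnn : 0 ≤ ∫ ω, U ω ∂P := integral_nonneg fun ω => (hVnn _).trans (hVU ω)
    calc ∫⁻ ω, ENNReal.ofReal (V (x - Z ω)) ∂P + 1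
        ≤ ∫⁻ ω, ENNReal.ofReal (U ω) ∂P + ENNReal.ofReal 1 := by
          rw [ENNReal.ofReal_one]
          gcongr with ω
          exact hVU ω
      _ = ENNReal.ofReal (V x) := by
          rw [← ofReal_integral_eq_lintegral_ofReal hUint
            (Eventually.of_forall fun ω => (hVnn _).trans (hVU ω)),
            ← ENNReal.ofReal_add hUnn zero_le_one, hUval, sub_add_cancel]

end Overshoot

/-! ### Delay of the GM-CuSum time by comparison with a random walk. -/

lemma coe_finsetSum_ereal {ι : Type*} (s : Finset ι) (f : ι → ℝ) :
    ((∑ i ∈ s, f i : ℝ) : EReal) = ∑ i ∈ s, (f i : EReal) := by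
  classical
  induction s using Finset.induction_on with
  | empty => simp
  | insert i s hi ih => rw [Finset.sum_insert hi, Finset.sum_insert hi, EReal.coe_add, ih]

lemma condLExp_le_const {Ω : Type*} {m m0 : MeasurableSpace Ω} (hm : m ≤ m0) (P : Measure[m0] Ω)
    [IsFiniteMeasure P] {f : Ω → ℝ≥0∞} {c : ℝ≥0∞}
    (h : ∀ A, MeasurableSet[m] A → ∫⁻ x in A, f x ∂P ≤ c * P A) :
    essSup (condLExp m P f) P ≤ c := by
  refine essSup_le_of_ae_le _ (ae_of_ae_trim hm ?_)
  refine ae_le_of_forall_setLIntegral_le_of_sigmaFinite₀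
    (measurable_condLExp m P f).aemeasurable fun A hA _ => ?_
  rw [setLIntegral_condLExp_trim hm P f hA, setLIntegral_const, trim_measurableSet_eq hm hA]
  exact h A hA

namespace SensorNetwork

variable {X : Type*} [MeasurableSpace X] {μ : Measure X} [SigmaFinite μ] {K n : ℕ}
  (N : SensorNetwork μ K n)

/-- The value `⊥` requires a vanishing numerator, which has mass zero under the mixture, and by
symmetry under each label. It must be excluded because a real-valued `φ` cannot stay below `⊥`. -/
lemma ae_mixtureLLR_ne_bot {k : Fin K} {s : Option (Fin K)} (hs : s = some k) (σ : N.Label s) :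
    ∀ᵐ y ∂N.sampleLaw σ, N.mixtureLLR k y ≠ ⊥ := by
  subst hs
  have hA : MeasurableSet (N.mixtureLLR k ⁻¹' {⊥}) :=
    N.measurable_mixtureLLR k (measurableSet_singleton _)
  rw [ae_iff]
  simp only [not_not]
  change N.sampleLaw σ (N.mixtureLLR k ⁻¹' {⊥}) = 0
  rw [← lintegral_indicator_one hA, N.lintegral_sampleLaw_eq σ (measurable_one.indicator hA),
    N.lintegral_mixtureLaw _ (measurable_one.indicator hA)]
  · rw [← lintegral_zero (μ := Measure.pi fun _ : Fin n => μ)]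
    refine lintegral_congr fun y => ?_
    by_cases hy : y ∈ N.mixtureLLR k ⁻¹' {⊥}
    · have : N.mixtureDensity (some k) y = 0 := by
        simpa [mixtureLLR, ENNReal.div_eq_zero_iff] using hy
      simp [this]
    · simp [Set.indicator_of_notMem hy]
  · intro e x
    simp only [Set.indicator, Set.mem_preimage, mixtureLLR_comp_perm, Pi.one_apply]

/-- While the procedure has not stopped, the walk with increments `φ(mixtureLLR k)` started at the
change point stays below `b`, and `V` of the remaining distance loses 1 per step in mean. The walk
ignores the samples before the change, so the bound holds on every event `A` of the past. The
freedom in `φ` admits truncation. -/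
lemma essSup_delay_gmCuSum_le {k : Fin K} {φ : EReal → ℝ} (hφ : Measurable φ)
    (hφle : ∀ z, z ≠ ⊥ → (φ z : EReal) ≤ z) {V : ℝ → ℝ} (hVm : Measurable V)
    (hV : ∀ x, 0 < x → ∫⁻ y, ENNReal.ofReal (V (x - φ (N.mixtureLLR k y)))
      ∂N.mixtureLaw (some k) + 1 ≤ ENNReal.ofReal (V x))
    {b : ℝ} (hb : 0 < b) {ν : ℕ} (hν : 1 ≤ ν) (L : ∀ i, N.Label (staticTrajectory k ν i)) :
    essSup (condLExp (history (Fin n → X) (ν - 1)) (N.pathLaw L)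
      fun x => ENat.toENNReal (N.gmCuSum b x) - (ν : ℝ≥0∞)) (N.pathLaw L) ≤
      ENNReal.ofReal (V b) := by
  refine condLExp_le_const (history_le_pi _) _ fun A hA => ?_
  set P := N.pathLaw L with hP
  set Z : (Fin n → X) → ℝ := fun y => φ (N.mixtureLLR k y) with hZ
  have hZm : Measurable Z := hφ.comp (N.measurable_mixtureLLR k)
  set S : ℕ → (ℕ → Fin n → X) → ℝ := fun m x => ∑ i ∈ Finset.Ico (ν - 1) (ν - 1 + m), Z (x i)
    with hS
  have hSm : ∀ m, Measurable[history (Fin n → X) (ν - 1 + m)] (S m) := fun m =>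
    Finset.measurable_sum _ fun i hi =>
      hZm.comp (measurable_eval_history (Finset.mem_Ico.1 hi).2)
  -- No passage within `m` steps. The walk starts at coordinate `ν - 1`, the first sample after the
  -- change.
  set B : ℕ → Set (ℕ → Fin n → X) := fun m => A ∩ {x | ∀ j ≤ m, 0 < b - S j x} with hB
  have hBm : ∀ m, MeasurableSet[history (Fin n → X) (ν - 1 + m)] (B m) := by
    intro m
    refine MeasurableSet.inter (history_mono (by omega) _ hA) ?_
    have : {x | ∀ j ≤ m, 0 < b - S j x} = ⋂ j, ⋂ (_ : j ≤ m), {x | 0 < b - S j x} := by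
      ext x; simp
    rw [this]
    refine MeasurableSet.iInter fun j => MeasurableSet.iInter fun hj => ?_
    have hSj := (hSm j).mono (history_mono (Nat.add_le_add_left hj (ν - 1))) le_rfl
    exact (hSj.const_sub b) measurableSet_Ioi
  have hBsub : ∀ m, B (m + 1) ⊆ B m := fun m x hx => ⟨hx.1, fun j hj => hx.2 j (by omega)⟩
  set u : ℕ → (ℕ → Fin n → X) → ℝ≥0∞ := fun m =>
    (B m).indicator fun x => ENNReal.ofReal (V (b - S m x)) with hu
  have hstep : ∀ m, ∫⁻ x, u (m + 1) x ∂P + P (B m) ≤ ∫⁻ x, u m x ∂P := by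
    intro m
    set t := ν - 1 + m with ht
    set F : (ℕ → Fin n → X) × (Fin n → X) → ℝ≥0∞ := fun z =>
      (B m).indicator 1 z.1 * ENNReal.ofReal (V (b - S m z.1 - Z z.2)) with hF
    have hFm : Measurable[(history (Fin n → X) t).prod inferInstance] F := by
      let := history (Fin n → X) t
      refine ((measurable_one.indicator (hBm m)).comp measurable_fst).mul
        (ENNReal.measurable_ofReal.comp (hVm.comp ?_))
      exact (measurable_const.sub ((hSm m).comp measurable_fst)).sub (hZm.comp measurable_snd)
    have h1 : ∫⁻ x, u (m + 1) x ∂P ≤ ∫⁻ x, F (x, x t) ∂P := by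
      refine lintegral_mono fun x => ?_
      by_cases hx : x ∈ B (m + 1)
      · have hSs : S (m + 1) x = S m x + Z (x t) := by
          simp only [hS, ht, ← add_assoc]
          rw [Finset.sum_Ico_succ_top (by omega)]
        simp only [hu, hF, Set.indicator_of_mem hx, Set.indicator_of_mem (hBsub m hx),
          Pi.one_apply, one_mul, hSs, sub_add_eq_sub_sub]
        exact le_rfl
      · simp only [hu, Set.indicator_of_notMem hx]
        exact zero_le
    have hst : staticTrajectory k ν t = some k := by
      simp only [staticTrajectory, ht]
      rw [if_neg (by omega)]
    have h2 : ∀ x, ∫⁻ y, F (x, y) ∂N.sampleLaw (L t) + (B m).indicator 1 x ≤ u m x := by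
      intro x
      by_cases hx : x ∈ B m
      · simp only [hF, hu, Set.indicator_of_mem hx, Pi.one_apply, one_mul]
        rw [N.lintegral_sampleLaw_eq (L t) (f := fun y => ENNReal.ofReal (V (b - S m x - Z y)))
          (ENNReal.measurable_ofReal.comp (hVm.comp (hZm.const_sub _))), hst]
        · exact hV _ (hx.2 m le_rfl)
        · intro e y
          simp only [hZ, mixtureLLR_comp_perm]
      · simp [hF, hu, Set.indicator_of_notMem hx]
    have hBm' : MeasurableSet (B m) := history_le_pi _ _ (hBm m)
    calc ∫⁻ x, u (m + 1) x ∂P + P (B m)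
        ≤ ∫⁻ x, F (x, x t) ∂P + P (B m) := by gcongr
      _ = ∫⁻ x, ∫⁻ y, F (x, y) ∂N.sampleLaw (L t) ∂P + P (B m) := by
          rw [hP, pathLaw, lintegral_infinitePi_history_eval _ t hFm]
      _ = ∫⁻ x, (∫⁻ y, F (x, y) ∂N.sampleLaw (L t) + (B m).indicator 1 x) ∂P := by
          rw [lintegral_add_right _ (measurable_one.indicator hBm'),
            lintegral_indicator_one hBm']
      _ ≤ _ := lintegral_mono h2
  have hsum : ∀ m, ∫⁻ x, u m x ∂P + ∑ j ∈ Finset.range m, P (B j) ≤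
      ENNReal.ofReal (V b) * P A := by
    intro m
    induction m with
    | zero =>
      have hB0 : B 0 = A := by
        simp [hB, hS, hb]
      have hA' := history_le_pi _ _ hA
      simp only [Finset.range_zero, Finset.sum_empty, add_zero, hu, hB0]
      simp only [hS, add_zero, Finset.Ico_self, Finset.sum_empty, sub_zero]
      rw [lintegral_indicator_const hA']
    | succ m ih =>
      rw [Finset.sum_range_succ, add_comm (∑ j ∈ _, _), ← add_assoc]
      exact (add_le_add_left (hstep m) _).trans ih
  have hne : ∀ᵐ x ∂P, ∀ i, ν - 1 ≤ i → N.mixtureLLR k (x i) ≠ ⊥ := by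
    rw [ae_all_iff]
    intro i
    rw [eventually_imp_distrib_left]
    intro hi
    have hst : staticTrajectory k ν i = some k := by
      simp only [staticTrajectory]
      rw [if_neg (by omega)]
    exact (measurePreserving_eval_infinitePi (fun i => N.sampleLaw (L i)) i).quasiMeasurePreserving.ae
      (N.ae_mixtureLLR_ne_bot hst (L i))
  have hA' := history_le_pi _ _ hA
  have hle : ∀ᵐ x ∂P, A.indicator
      (fun x => ENat.toENNReal (N.gmCuSum b x) - (ν : ℝ≥0∞)) x ≤
      ∑' s, (B s).indicator 1 x := by
    filter_upwards [hne] with x hx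
    by_cases hxA : x ∈ A
    swap
    · rw [Set.indicator_of_notMem hxA]; exact zero_le
    rw [Set.indicator_of_mem hxA, toENNReal_sub_eq_tsum_indicator]
    refine ENNReal.tsum_le_tsum fun s => ?_
    by_cases hs : x ∈ {x | ((ν + s : ℕ) : WithTop ℕ) < N.gmCuSum b x}
    swap
    · rw [Set.indicator_of_notMem hs]; exact zero_le
    -- Survival beyond `ν + s` controls the walk up to step `s + 1`; steps up to `s` suffice. Step 0
    -- has no starting time in the statistic and rests on `0 < b`.
    have hxB : x ∈ B s := by
      refine ⟨hxA, fun j hj => ?_⟩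
      rcases Nat.eq_zero_or_pos j with rfl | hj0
      · simpa [hS] using hb
      have hlt : ((ν - 1 + j : ℕ) : WithTop ℕ) < N.gmCuSum b x :=
        lt_of_le_of_lt (Nat.cast_le.2 (by omega)) hs
      have hnot := notMem_of_lt_hittingAfter (k := ν - 1 + j) hlt (by omega)
      rw [Set.mem_Ici, not_le] at hnot
      have h1 : (S j x : EReal) ≤ N.statistic (ν - 1 + j) x := by
        refine le_trans ?_ (le_iSup₂ (f := fun (k : Fin K) (i : Fin (ν - 1 + j)) =>
          ∑ i ∈ Finset.Ico (i : ℕ) (ν - 1 + j), N.mixtureLLR k (x i)) k ⟨ν - 1, by omega⟩)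
        simp only [hS, coe_finsetSum_ereal]
        exact Finset.sum_le_sum fun i hi => hφle _ (hx i (Finset.mem_Ico.1 hi).1)
      have h2 : S j x < b := EReal.coe_lt_coe_iff.1 (h1.trans_lt hnot)
      linarith
    rw [Set.indicator_of_mem hs, Set.indicator_of_mem hxB]
  calc ∫⁻ x in A, (ENat.toENNReal (N.gmCuSum b x) - (ν : ℝ≥0∞)) ∂P
      ≤ ∫⁻ x, ∑' s, (B s).indicator 1 x ∂P := by
        rw [← lintegral_indicator hA']
        exact lintegral_mono_ae hle
    _ = ∑' s, P (B s) := by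
        have hBm' : ∀ m, MeasurableSet (B m) := fun m => history_le_pi _ _ (hBm m)
        rw [lintegral_tsum fun s => (measurable_one.indicator (hBm' s)).aemeasurable]
        exact tsum_congr fun s => lintegral_indicator_one (hBm' s)
    _ ≤ _ := ENNReal.tsum_le_of_sum_range_le fun m => le_add_self.trans (hsum m)

end SensorNetwork

/-! ### Truncated log-likelihood ratios and the divergence. -/

lemma toReal_ennrealLog (z : ℝ≥0∞) : (ENNReal.log z).toReal = Real.log z.toReal := by
  rcases eq_or_ne z 0 with rfl | h0
  · simp
  rcases eq_or_ne z ⊤ with rfl | h1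
  · simp
  rw [ENNReal.log_pos_real h0 h1, EReal.toReal_coe]

/-- The truncation of an extended real number from above by `M`, as a real number. -/
def truncateAbove (M : ℕ) (z : EReal) : ℝ := (min z ((M : ℝ) : EReal)).toReal

lemma measurable_truncateAbove (M : ℕ) : Measurable (truncateAbove M) :=
  (measurable_id.min measurable_const).ereal_toReal

lemma truncateAbove_coe (M : ℕ) (r : ℝ) : truncateAbove M r = min r M := by
  unfold truncateAbove
  rw [← EReal.coe_strictMono.monotone.map_min, EReal.toReal_coe]

lemma truncateAbove_top (M : ℕ) : truncateAbove M ⊤ = M := by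
  rw [truncateAbove, min_eq_right le_top, EReal.toReal_coe]

lemma truncateAbove_bot (M : ℕ) : truncateAbove M ⊥ = 0 := by simp [truncateAbove]

lemma truncateAbove_le (M : ℕ) (z : EReal) : truncateAbove M z ≤ M := by
  induction z with
  | bot => rw [truncateAbove_bot]; exact M.cast_nonneg
  | coe r => rw [truncateAbove_coe]; exact min_le_right _ _
  | top => rw [truncateAbove_top]

lemma coe_truncateAbove_le (M : ℕ) {z : EReal} (hz : z ≠ ⊥) : (truncateAbove M z : EReal) ≤ z := by
  induction z with
  | bot => exact absurd rfl hz
  | coe r => rw [truncateAbove_coe]; exact EReal.coe_le_coe_iff.2 (min_le_left _ _)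
  | top => exact le_top

lemma ofReal_truncateAbove_sub (M : ℕ) (z : EReal) :
    ENNReal.ofReal (truncateAbove M z - truncateAbove 0 z) = min z.toENNReal M := by
  have hM : (0 : ℝ) ≤ M := M.cast_nonneg
  induction z with
  | bot => simp [truncateAbove_bot]
  | coe r =>
    rw [truncateAbove_coe, truncateAbove_coe, Nat.cast_zero, EReal.toENNReal_of_ne_top (EReal.coe_ne_top r), EReal.toReal_coe,
      ← ENNReal.ofReal_natCast, ← ENNReal.ofReal_mono.map_min]
    rcases le_total r 0 with h | h
    · rw [min_eq_left (h.trans hM), min_eq_left h, sub_self, ENNReal.ofReal_zero,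
        ENNReal.ofReal_of_nonpos h]
    · rw [min_eq_right h, sub_zero]
  | top => simp [truncateAbove_top]

/-- From `log z⁻¹ ≤ z⁻¹ - 1`. Since `z⁻¹` has mean at most 1 under the post-change mixture when `z`
is the likelihood ratio, the negative part is always integrable. -/
lemma ofReal_neg_truncateAbove_log_le (M : ℕ) {z : ℝ≥0∞} :
    ENNReal.ofReal (-truncateAbove M (ENNReal.log z)) ≤ z⁻¹ := by
  rcases eq_or_ne z 0 with rfl | h0
  · simp
  rcases eq_or_ne z ⊤ with rfl | h1
  · simp [truncateAbove_top]
  have hz : 0 < z.toReal := ENNReal.toReal_pos h0 h1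
  have hM : (0 : ℝ) ≤ M := M.cast_nonneg
  rw [ENNReal.log_pos_real h0 h1, truncateAbove_coe, ← ENNReal.ofReal_toReal h1,
    ← ENNReal.ofReal_inv_of_pos hz, ENNReal.toReal_ofReal hz.le]
  refine ENNReal.ofReal_le_ofReal ?_
  rw [neg_le, le_min_iff]
  have h2 := Real.log_le_sub_one_of_pos (inv_pos.2 hz)
  rw [Real.log_inv] at h2
  have h3 : 0 < z.toReal⁻¹ := inv_pos.2 hz
  constructor <;> linarith

lemma iSup_min_natCast (z : ℝ≥0∞) : ⨆ M : ℕ, min z (M : ℝ≥0∞) = z := by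
  rw [← inf_iSup_eq, ENNReal.iSup_natCast, inf_top_eq]

namespace SensorNetwork

variable {X : Type*} [MeasurableSpace X] {μ : Measure X} [SigmaFinite μ] {K n : ℕ}
  (N : SensorNetwork μ K n)

/-- The part of the post-change mixture singular to the pre-change one lives where the ratio is `⊤`.
-/
lemma mixtureLaw_eq_withDensity_mixtureLR {k : Fin K}
    (h : ∀ᵐ y ∂N.mixtureLaw (some k), N.mixtureLR k y ≠ ⊤) :
    N.mixtureLaw (some k) = (N.mixtureLaw none).withDensity (N.mixtureLR k) := by
  have hm := fun s => (N.measurable_mixtureDensity s).coe_nnreal_ennreal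
  rw [mixtureLaw_eq_withDensity, ae_withDensity_iff (hm _)] at h
  rw [mixtureLaw_eq_withDensity, mixtureLaw_eq_withDensity,
    ← withDensity_mul _ (hm _) (N.measurable_mixtureLR k)]
  refine withDensity_congr_ae ?_
  filter_upwards [h] with y hy
  simp only [Pi.mul_apply]
  by_cases h0 : N.mixtureDensity none y = 0
  · by_cases h1 : N.mixtureDensity (some k) y = 0
    · simp [h0, h1]
    · refine absurd ?_ (hy (by simpa using h1))
      simp [mixtureLR, h0, ENNReal.div_zero, h1]
  · rw [mixtureLR, ENNReal.mul_div_cancel (by simpa using h0) (by simp)]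

lemma ae_mixtureLR_ne_top (k : Fin K) : ∀ᵐ y ∂N.mixtureLaw none, N.mixtureLR k y ≠ ⊤ := by
  have := ae_lt_top (N.measurable_mixtureLR k)
    ((N.lintegral_mixtureLR_le_one k).trans_lt ENNReal.one_lt_top).ne
  filter_upwards [this] with y hy using hy.ne

lemma mixtureLaw_eq_withDensity_of_ac {k : Fin K}
    (h : N.mixtureLaw (some k) ≪ N.mixtureLaw none) :
    N.mixtureLaw (some k) = (N.mixtureLaw none).withDensity (N.mixtureLR k) :=
  N.mixtureLaw_eq_withDensity_mixtureLR (h.ae_le (N.ae_mixtureLR_ne_top k))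

lemma llr_mixtureLaw_ae_eq {k : Fin K} (h : N.mixtureLaw (some k) ≪ N.mixtureLaw none) :
    llr (N.mixtureLaw (some k)) (N.mixtureLaw none) =ᵐ[N.mixtureLaw (some k)]
      fun y => (N.mixtureLLR k y).toReal := by
  have h1 : (N.mixtureLaw (some k)).rnDeriv (N.mixtureLaw none) =ᵐ[N.mixtureLaw none]
      N.mixtureLR k := by
    conv_lhs => rw [N.mixtureLaw_eq_withDensity_of_ac h]
    exact Measure.rnDeriv_withDensity _ (N.measurable_mixtureLR k)
  filter_upwards [h.ae_le h1] with y hy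
  rw [llr, hy, mixtureLLR_eq_log, toReal_ennrealLog]

lemma toReal_klInfo {k : Fin K} (h : N.mixtureLaw (some k) ≪ N.mixtureLaw none) :
    (N.klInfo k).toReal = ∫ y, (N.mixtureLLR k y).toReal ∂N.mixtureLaw (some k) := by
  rw [klInfo, InformationTheory.toReal_klDiv_of_measure_eq h (by simp),
    integral_congr_ae (N.llr_mixtureLaw_ae_eq h)]

lemma klInfo_ne_top_iff (k : Fin K) : N.klInfo k ≠ ∞ ↔
    N.mixtureLaw (some k) ≪ N.mixtureLaw none ∧
      Integrable (fun y => (N.mixtureLLR k y).toReal) (N.mixtureLaw (some k)) := by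
  rw [klInfo, InformationTheory.klDiv_ne_top_iff]
  exact and_congr_right fun h => integrable_congr (N.llr_mixtureLaw_ae_eq h)

lemma lintegral_mixtureLR_inv_le_one (k : Fin K) :
    ∫⁻ y, (N.mixtureLR k y)⁻¹ ∂N.mixtureLaw (some k) ≤ 1 := by
  rw [lintegral_mixtureLaw _ _ (f := fun y => (N.mixtureLR k y)⁻¹)
    (N.measurable_mixtureLR k).inv, ← N.lintegral_mixtureDensity none]
  refine lintegral_mono fun y => ?_
  rcases eq_or_ne (N.mixtureDensity (some k) y) 0 with h | h
  · simp [h]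
  · rw [mixtureLR, ENNReal.inv_div (by simp) (by simp [h])]
    exact ENNReal.mul_div_le

lemma integrable_truncateAbove_mixtureLLR (k : Fin K) (M : ℕ) :
    Integrable (fun y => truncateAbove M (N.mixtureLLR k y)) (N.mixtureLaw (some k)) := by
  have hm : Measurable fun y => truncateAbove M (N.mixtureLLR k y) :=
    (measurable_truncateAbove M).comp (N.measurable_mixtureLLR k)
  refine ⟨hm.aestronglyMeasurable, ?_⟩
  rw [hasFiniteIntegral_iff_norm]
  have hle : ∀ y, ENNReal.ofReal ‖truncateAbove M (N.mixtureLLR k y)‖ ≤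
      M + (N.mixtureLR k y)⁻¹ := by
    intro y
    rw [Real.norm_eq_abs]
    rcases abs_cases (truncateAbove M (N.mixtureLLR k y)) with ⟨h, _⟩ | ⟨h, _⟩ <;> rw [h]
    · rw [← ENNReal.ofReal_natCast]
      exact (ENNReal.ofReal_le_ofReal (truncateAbove_le M _)).trans le_self_add
    · exact (ofReal_neg_truncateAbove_log_le M).trans le_add_self
  refine (lintegral_mono hle).trans_lt ?_
  rw [lintegral_add_left measurable_const]
  refine ENNReal.add_lt_top.2 ⟨by simp, (N.lintegral_mixtureLR_inv_le_one k).trans_lt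
    ENNReal.one_lt_top⟩

/-- The means of the truncated log-likelihood ratios exhaust the divergence. -/
lemma exists_lt_integral_truncateAbove {k : Fin K} {c : ℝ} (hc : 0 ≤ c)
    (h : ENNReal.ofReal c < N.klInfo k) :
    ∃ M, c < ∫ y, truncateAbove M (N.mixtureLLR k y) ∂N.mixtureLaw (some k) := by
  by_contra! hcon
  set Q := N.mixtureLaw (some k) with hQ
  have hint := N.integrable_truncateAbove_mixtureLLR k
  set c₀ := ∫ y, truncateAbove 0 (N.mixtureLLR k y) ∂Q with hc₀
  have hpos : Measurable fun y => (N.mixtureLLR k y).toENNReal :=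
    (N.measurable_mixtureLLR k).ereal_toENNReal
  -- Subtracting the truncation at 0 leaves the positive part cut at `M`. The bound is uniform in
  -- `M`, so monotone convergence controls the whole positive part.
  have hM : ∀ M : ℕ, ∫⁻ y, min (N.mixtureLLR k y).toENNReal M ∂Q ≤ ENNReal.ofReal (c - c₀) := by
    intro M
    have hnn : ∀ y, 0 ≤ truncateAbove M (N.mixtureLLR k y) - truncateAbove 0 (N.mixtureLLR k y) := by
      intro y
      induction N.mixtureLLR k y with
      | bot => simp [truncateAbove_bot]
      | coe r =>
        simp only [truncateAbove_coe, sub_nonneg]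
        exact min_le_min le_rfl (by simp)
      | top => simp [truncateAbove_top]
    simp_rw [← ofReal_truncateAbove_sub]
    rw [← ofReal_integral_eq_lintegral_ofReal (f := fun y => truncateAbove M (N.mixtureLLR k y) -
      truncateAbove 0 (N.mixtureLLR k y)) ((hint M).sub (hint 0)) (Eventually.of_forall hnn),
      integral_sub (hint M) (hint 0)]
    exact ENNReal.ofReal_le_ofReal (sub_le_sub_right (hcon M) _)
  have hfin : ∫⁻ y, (N.mixtureLLR k y).toENNReal ∂Q ≤ ENNReal.ofReal (c - c₀) := by
    calc _ = ∫⁻ y, ⨆ M : ℕ, min (N.mixtureLLR k y).toENNReal M ∂Q := by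
          simp_rw [iSup_min_natCast]
      _ = ⨆ M : ℕ, ∫⁻ y, min (N.mixtureLLR k y).toENNReal M ∂Q :=
          lintegral_iSup (fun M => hpos.min measurable_const) fun M M' hMM y =>
            min_le_min le_rfl (by exact_mod_cast hMM)
      _ ≤ _ := iSup_le hM
  have hlt : ∀ᵐ y ∂Q, (N.mixtureLLR k y).toENNReal < ⊤ :=
    ae_lt_top hpos (hfin.trans_lt ENNReal.ofReal_lt_top).ne
  -- An integrable positive part excludes the value `⊤`, hence a singular part; this covers
  -- divergences that are infinite for lack of absolute continuity.
  have hac : Q ≪ N.mixtureLaw none := by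
    rw [hQ, N.mixtureLaw_eq_withDensity_mixtureLR (k := k)]
    · exact withDensity_absolutelyContinuous _ _
    · filter_upwards [hlt] with y hy htop
      simp [mixtureLLR_eq_log, htop] at hy
  have heq : (fun y => (N.mixtureLLR k y).toReal) =ᵐ[Q] fun y =>
      truncateAbove 0 (N.mixtureLLR k y) + (N.mixtureLLR k y).toENNReal.toReal := by
    filter_upwards [hlt] with y hy
    revert hy
    induction N.mixtureLLR k y with
    | bot => simp [truncateAbove_bot]
    | coe r =>
      intro _
      rw [truncateAbove_coe, EReal.toENNReal_of_ne_top (EReal.coe_ne_top r), EReal.toReal_coe, ENNReal.toReal_ofReal']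
      simp [min_add_max]
    | top => simp
  have hpint : Integrable (fun y => (N.mixtureLLR k y).toENNReal.toReal) Q :=
    integrable_toReal_of_lintegral_ne_top hpos.aemeasurable
      (hfin.trans_lt ENNReal.ofReal_lt_top).ne
  have hLint : Integrable (fun y => (N.mixtureLLR k y).toReal) Q :=
    (integrable_congr heq).2 ((hint 0).add hpint)
  have hc₀c : 0 ≤ c - c₀ := by
    have : c₀ ≤ 0 := integral_nonpos fun y => by simpa using truncateAbove_le 0 (N.mixtureLLR k y)
    linarith
  have hle : (N.klInfo k).toReal ≤ c := by
    rw [N.toReal_klInfo hac, integral_congr_ae heq, integral_add (hint 0) hpint,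
      integral_toReal hpos.aemeasurable hlt]
    have := ENNReal.toReal_mono ENNReal.ofReal_ne_top hfin
    rw [ENNReal.toReal_ofReal hc₀c] at this
    linarith
  have htop : N.klInfo k ≠ ∞ := (N.klInfo_ne_top_iff k).2 ⟨hac, hLint⟩
  rw [← ENNReal.ofReal_toReal htop] at h
  exact absurd (ENNReal.ofReal_le_ofReal hle) (not_le.2 h)

/-- The conditional mean delay of the GM-CuSum time for anomalies of type `k`. -/
theorem exists_essSup_delay_gmCuSum_le (hI_pos : N.klInfoMin ≠ 0) (hI_fin : N.klInfoMin ≠ ∞)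
    (k : Fin K) (hk : N.klInfo k = N.klInfoMin →
      MemLp (fun x => (N.mixtureLLR k x).toReal) 2 (N.mixtureLaw (some k))) :
    ∃ C : ℝ≥0, ∀ b : ℝ, 0 < b → ∀ ν : ℕ, 1 ≤ ν → ∀ L : ∀ i, N.Label (staticTrajectory k ν i),
      essSup (condLExp (history (Fin n → X) (ν - 1)) (N.pathLaw L)
        fun x => ENat.toENNReal (N.gmCuSum b x) - (ν : ℝ≥0∞)) (N.pathLaw L) ≤
        ENNReal.ofReal b / N.klInfoMin + C := by
  set I := N.klInfoMin.toReal with hI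
  have hIpos : 0 < I := ENNReal.toReal_pos hI_pos hI_fin
  have hIeq : N.klInfoMin = ENNReal.ofReal I := (ENNReal.ofReal_toReal hI_fin).symm
  -- For a minimizing type, `φ` is the full log-likelihood ratio, with its assumed second moment.
  -- For the others the slack `I_k > I*` allows a truncation of mean above `I*`, whose positive part
  -- is bounded.
  obtain ⟨φ, hφ, hφle, hint, hmean, hsq⟩ : ∃ φ : EReal → ℝ, Measurable φ ∧
      (∀ z, z ≠ ⊥ → (φ z : EReal) ≤ z) ∧
      Integrable (fun y => φ (N.mixtureLLR k y)) (N.mixtureLaw (some k)) ∧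
      I ≤ ∫ y, φ (N.mixtureLLR k y) ∂N.mixtureLaw (some k) ∧
      Integrable (fun y => (max (φ (N.mixtureLLR k y)) 0) ^ 2) (N.mixtureLaw (some k)) := by
    by_cases hkI : N.klInfo k = N.klInfoMin
    · have hfin := (N.klInfo_ne_top_iff k).1 (hkI ▸ hI_fin)
      refine ⟨EReal.toReal, measurable_ereal_toReal, fun z hz => EReal.coe_toReal_le hz, hfin.2,
        ?_, ?_⟩
      · rw [hI, ← hkI, N.toReal_klInfo hfin.1]
      · refine (hk hkI).integrable_sq.mono' ?_ (Eventually.of_forall fun y => ?_)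
        · exact hfin.2.pos_part.aestronglyMeasurable.pow 2
        · rw [Real.norm_eq_abs, abs_of_nonneg (sq_nonneg _)]
          rcases max_cases (N.mixtureLLR k y).toReal 0 with ⟨h, _⟩ | ⟨h, _⟩ <;> rw [h]
          simpa using sq_nonneg _
    · have hlt : ENNReal.ofReal I < N.klInfo k :=
        hIeq ▸ lt_of_le_of_ne (iInf_le _ k) (Ne.symm hkI)
      obtain ⟨M, hM⟩ := N.exists_lt_integral_truncateAbove hIpos.le hlt
      have hi := N.integrable_truncateAbove_mixtureLLR k M
      refine ⟨truncateAbove M, measurable_truncateAbove M, fun z hz => coe_truncateAbove_le M hz,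
        hi, hM.le, ?_⟩
      refine (integrable_const ((M : ℝ) ^ 2)).mono' (hi.pos_part.aestronglyMeasurable.pow 2)
        (Eventually.of_forall fun y => ?_)
      rw [Real.norm_eq_abs, abs_of_nonneg (sq_nonneg _)]
      exact pow_le_pow_left₀ (le_max_right _ _)
        (max_le (truncateAbove_le M _) M.cast_nonneg) 2
  obtain ⟨V, C, hVm, hC, hVle, hV⟩ := exists_passage_lyapunov hint (hIpos.trans_le hmean) hsq
  refine ⟨C.toNNReal, fun b hb ν hν L =>
    (N.essSup_delay_gmCuSum_le hφ hφle hVm hV hb hν L).trans ?_⟩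
  have h1 : V b ≤ b / I + C := (hVle b hb).trans (by gcongr)
  calc ENNReal.ofReal (V b) ≤ ENNReal.ofReal (b / I + C) := ENNReal.ofReal_le_ofReal h1
    _ = _ := by
      rw [ENNReal.ofReal_add (by positivity) hC, hIeq, ENNReal.ofReal_div_of_pos hIpos]
      rfl

end SensorNetwork

/-! ### A Lyapunov function for the CuSum process without change. -/

section LikelihoodRatio

variable {Y : Type*} [MeasurableSpace Y] {Q : Measure Y} [IsProbabilityMeasure Q] {ℓ : Y → ℝ}

lemma integrable_sqrt_of_integrable (hℓ : Integrable ℓ Q) (h0 : ∀ y, 0 ≤ ℓ y) :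
    Integrable (fun y => √(ℓ y)) Q := by
  refine ((integrable_const (1 : ℝ)).add hℓ).mono'
    (Real.continuous_sqrt.comp_aestronglyMeasurable hℓ.aestronglyMeasurable)
    (Eventually.of_forall fun y => ?_)
  rw [Real.norm_eq_abs, abs_of_nonneg (Real.sqrt_nonneg _)]
  change √(ℓ y) ≤ 1 + ℓ y
  nlinarith [Real.sq_sqrt (h0 y), sq_nonneg (√(ℓ y) - 1)]

/-- The Bhattacharyya coefficient is less than one when the divergence is positive. -/
lemma integral_sqrt_lt_one (hℓ : Integrable ℓ Q) (h0 : ∀ y, 0 ≤ ℓ y) (h1 : ∫ y, ℓ y ∂Q = 1)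
    (hI : 0 < ∫ y, ℓ y * Real.log (ℓ y) ∂Q) : ∫ y, √(ℓ y) ∂Q < 1 := by
  by_contra! hcon
  have hs := integrable_sqrt_of_integrable hℓ h0
  have e : ∀ y, (√(ℓ y) - 1) ^ 2 = ℓ y - 2 * √(ℓ y) + 1 := fun y => by
    nlinarith [Real.sq_sqrt (h0 y)]
  have i1 : Integrable (fun y => ℓ y - 2 * √(ℓ y)) Q := hℓ.sub (hs.const_mul 2)
  -- This mean is `2 - 2 ∫ √ℓ`. If it vanishes, `ℓ = 1` almost everywhere and the divergence is
  -- zero.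
  have hsq : ∫ y, (√(ℓ y) - 1) ^ 2 ∂Q ≤ 0 := by
    simp_rw [e]
    rw [integral_add i1 (integrable_const _), integral_sub hℓ (hs.const_mul 2),
      integral_const_mul, h1]
    simp only [integral_const, probReal_univ, one_smul]
    linarith
  have hint : Integrable (fun y => (√(ℓ y) - 1) ^ 2) Q := by
    simp_rw [e]
    exact i1.add (integrable_const _)
  have hz := (integral_eq_zero_iff_of_nonneg (fun y => sq_nonneg _) hint).1
    (le_antisymm hsq (integral_nonneg fun y => sq_nonneg _))
  have hzero : ∫ y, ℓ y * Real.log (ℓ y) ∂Q = 0 := by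
    refine integral_eq_zero_of_ae ?_
    filter_upwards [hz] with y hy
    have h2 : √(ℓ y) = 1 := by
      have := pow_eq_zero_iff (two_ne_zero) |>.1 hy
      linarith
    have h3 : ℓ y = 1 := by rw [← Real.sq_sqrt (h0 y), h2, one_pow]
    simp [h3]
  exact hI.ne' hzero

/-- A Lyapunov function for the CuSum process under the law without change. The parameter `d` is
the price of the reflection at `1`. -/
def cusumLyapunov (I d x : ℝ) : ℝ :=
  x * Real.log x / I - (d + 1 / I + 1) * x + √x + Real.exp (I * (d + 1)) / I

lemma measurable_cusumLyapunov (I d : ℝ) : Measurable (cusumLyapunov I d) := by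
  unfold cusumLyapunov
  fun_prop

lemma cusumLyapunov_zero (I d : ℝ) : cusumLyapunov I d 0 = Real.exp (I * (d + 1)) / I := by
  simp [cusumLyapunov]

/-- The additive constant offsets the minimum of the terms other than `√x`, attained at `x = exp (I
(d + 1))`. This constant is where the exponential dependence on the delay originates. -/
lemma cusumLyapunov_nonneg {I : ℝ} (hI : 0 < I) (d : ℝ) {x : ℝ} (hx : 0 ≤ x) :
    0 ≤ cusumLyapunov I d x := by
  rcases hx.eq_or_lt with rfl | hx
  · rw [cusumLyapunov_zero]; positivity
  have h1 := Real.add_one_le_exp (I * (d + 1) - Real.log x)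
  rw [Real.exp_sub, Real.exp_log hx, le_div_iff₀ hx] at h1
  have h2 : cusumLyapunov I d x = (x * Real.log x - (I * (d + 1) + 1) * x +
      Real.exp (I * (d + 1))) / I + √x := by
    unfold cusumLyapunov
    field_simp
    ring
  rw [h2]
  have h3 : 0 ≤ x * Real.log x - (I * (d + 1) + 1) * x + Real.exp (I * (d + 1)) := by linarith
  positivity

/-- With `u = max 1 x`, the mean after one step is the value at `u` plus `u`, from `x log x / I`,
minus `(1 - ρ) √u`, from the square root. If `x < 1`, raising `x` to 1 costs `d + 1/I + 1` per unit:
`d` is the price of reflection, while `1/I` and `1` cover the changes of `x log x / I` and `√x`. -/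
lemma lintegral_cusumLyapunov_le (hℓ : Integrable ℓ Q) (h0 : ∀ y, 0 ≤ ℓ y)
    (h1 : ∫ y, ℓ y ∂Q = 1) (hint : Integrable (fun y => ℓ y * Real.log (ℓ y)) Q) {I : ℝ}
    (hIeq : ∫ y, ℓ y * Real.log (ℓ y) ∂Q = I) (hI : 0 < I) {d : ℝ} (hd : 0 ≤ d) {x : ℝ}
    (hx : 0 ≤ x) :
    ∫⁻ y, ENNReal.ofReal (cusumLyapunov I d (max 1 x * ℓ y)) ∂Q +
      (ENNReal.ofReal d * ENNReal.ofReal (1 - x) + ENNReal.ofReal (1 - ∫ y, √(ℓ y) ∂Q)) ≤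
      ENNReal.ofReal (cusumLyapunov I d x) + ENNReal.ofReal (max 1 x) := by
  set ρ := ∫ y, √(ℓ y) ∂Q with hρ
  have hρ1 : ρ < 1 := integral_sqrt_lt_one hℓ h0 h1 (hIeq ▸ hI)
  set u := max 1 x with hu
  have hu1 : 1 ≤ u := le_max_left _ _
  have hs := integrable_sqrt_of_integrable hℓ h0
  set c := d + 1 / I + 1 with hc
  set B := Real.exp (I * (d + 1)) / I with hB
  have e : ∀ y, cusumLyapunov I d (u * ℓ y) =
      u / I * (ℓ y * Real.log (ℓ y)) + (u * Real.log u / I - c * u) * ℓ y + √u * √(ℓ y) + B := by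
    intro y
    have h2 : u * ℓ y * Real.log (u * ℓ y) =
        u * Real.log u * ℓ y + u * (ℓ y * Real.log (ℓ y)) := by
      rcases (h0 y).eq_or_lt with h | h
      · simp [← h]
      · rw [Real.log_mul (by positivity) h.ne']; ring
    unfold cusumLyapunov
    rw [h2, Real.sqrt_mul (by positivity)]
    ring
  have i1 : Integrable (fun y => u / I * (ℓ y * Real.log (ℓ y)) +
      (u * Real.log u / I - c * u) * ℓ y) Q := (hint.const_mul _).add (hℓ.const_mul _)
  have i2 : Integrable (fun y => u / I * (ℓ y * Real.log (ℓ y)) +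
      (u * Real.log u / I - c * u) * ℓ y + √u * √(ℓ y)) Q := i1.add (hs.const_mul _)
  have hVint : Integrable (fun y => cusumLyapunov I d (u * ℓ y)) Q := by
    simp_rw [e]
    exact i2.add (integrable_const _)
  have hVval : ∫ y, cusumLyapunov I d (u * ℓ y) ∂Q =
      u + (u * Real.log u / I - c * u) + √u * ρ + B := by
    simp_rw [e]
    rw [integral_add i2 (integrable_const _), integral_add i1 (hs.const_mul _),
      integral_add (hint.const_mul _) (hℓ.const_mul _), integral_const_mul, integral_const_mul,
      integral_const_mul, hIeq, h1]
    simp only [integral_const, probReal_univ, one_smul, mul_one]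
    rw [div_mul_cancel₀ _ hI.ne']
  have hVnn : ∀ y, 0 ≤ cusumLyapunov I d (u * ℓ y) := fun y =>
    cusumLyapunov_nonneg hI d (mul_nonneg (by linarith) (h0 y))
  have hVnn' : 0 ≤ ∫ y, cusumLyapunov I d (u * ℓ y) ∂Q := integral_nonneg hVnn
  have key : ∫ y, cusumLyapunov I d (u * ℓ y) ∂Q + (d * max (1 - x) 0 + (1 - ρ)) ≤
      cusumLyapunov I d x + u := by
    rw [hVval]
    unfold cusumLyapunov
    rw [← hc, ← hB]
    rcases le_total 1 x with h | h
    · have hux : u = x := max_eq_right h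
      have h2 : 1 ≤ √x := Real.one_le_sqrt.2 h
      rw [hux, max_eq_right (by linarith)]
      nlinarith
    · have hux : u = 1 := max_eq_left h
      rw [hux, max_eq_left (by linarith)]
      simp only [Real.log_one, mul_zero, zero_div, Real.sqrt_one, mul_one]
      have h2 : -(1 - x) ≤ x * Real.log x := by
        rcases hx.eq_or_lt with rfl | hx
        · simp
        · have h3 := Real.one_sub_inv_le_log_of_pos hx
          have h4 := mul_le_mul_of_nonneg_left h3 hx.le
          rw [mul_sub, mul_inv_cancel₀ hx.ne'] at h4
          linarith
      have h3 : -(1 - x) / I ≤ x * Real.log x / I := (div_le_div_iff_of_pos_right hI).2 h2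
      have h4 : x ≤ √x := Real.le_sqrt_of_sq_le (by nlinarith)
      have h5 : c * (1 - x) = d * (1 - x) + (1 - x) / I + (1 - x) := by rw [hc]; ring
      have h6 : -(1 - x) / I = -((1 - x) / I) := by ring
      nlinarith
  have hmax : ENNReal.ofReal (1 - x) = ENNReal.ofReal (max (1 - x) 0) := by
    rcases le_total (1 - x) 0 with h | h
    · rw [max_eq_right h, ENNReal.ofReal_of_nonpos h, ENNReal.ofReal_zero]
    · rw [max_eq_left h]
  have hm0 : 0 ≤ max (1 - x) 0 := le_max_right _ _
  rw [← ofReal_integral_eq_lintegral_ofReal hVint (Eventually.of_forall hVnn), hmax,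
    ← ENNReal.ofReal_mul hd, ← ENNReal.ofReal_add (by positivity) (by linarith),
    ← ENNReal.ofReal_add hVnn' (add_nonneg (by positivity) (by linarith)),
    ← ENNReal.ofReal_add (cusumLyapunov_nonneg hI d hx) (by linarith)]
  exact ENNReal.ofReal_le_ofReal key

end LikelihoodRatio

/-! ### Moustakides' inequality and the i.i.d. lower bound. -/

section Cusum

variable {Y : Type*} (ℓ : Y → ℝ)

/-- The CuSum statistic in multiplicative form, for the likelihood ratio `ℓ`. -/
def cusum : ℕ → (ℕ → Y) → ℝ
  | 0, _ => 0
  | t + 1, x => max 1 (cusum t x) * ℓ (x t)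

variable {ℓ}

lemma cusum_nonneg (h0 : ∀ y, 0 ≤ ℓ y) (t : ℕ) (x : ℕ → Y) : 0 ≤ cusum ℓ t x := by
  cases t with
  | zero => exact le_rfl
  | succ t => exact mul_nonneg (zero_le_one.trans (le_max_left _ _)) (h0 _)

/-- Induction from `max 1 M = M + (1 - M)⁺` and `M_{t+1} = max 1 M_t * ℓ`. The weights `(1 - M_s)⁺`
on the change points thus mix the likelihood ratios into the CuSum process. -/
lemma sum_cusum_eq (h0 : ∀ y, 0 ≤ ℓ y) (t : ℕ) (x : ℕ → Y) :
    ∑ s ∈ Finset.range (t + 1), ENNReal.ofReal (1 - cusum ℓ s x) *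
      ∏ i ∈ Finset.Ico s t, ENNReal.ofReal (ℓ (x i)) = ENNReal.ofReal (max 1 (cusum ℓ t x)) := by
  have hsplit : ∀ t, ENNReal.ofReal (max 1 (cusum ℓ t x)) =
      ENNReal.ofReal (cusum ℓ t x) + ENNReal.ofReal (1 - cusum ℓ t x) := by
    intro t
    rcases le_total 1 (cusum ℓ t x) with h | h
    · rw [max_eq_right h, ENNReal.ofReal_of_nonpos (sub_nonpos.2 h), add_zero]
    · rw [max_eq_left h, ← ENNReal.ofReal_add (cusum_nonneg h0 t x) (sub_nonneg.2 h),
        add_sub_cancel]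
  induction t with
  | zero => simp [cusum]
  | succ t ih =>
    rw [Finset.sum_range_succ, hsplit (t + 1), Finset.Ico_self, Finset.prod_empty, mul_one]
    congr 1
    rw [cusum, ENNReal.ofReal_mul (zero_le_one.trans (le_max_left _ _)), ← ih, Finset.sum_mul]
    refine Finset.sum_congr rfl fun s hs => ?_
    rw [Finset.prod_Ico_succ_top (Nat.lt_succ_iff.1 (Finset.mem_range.1 hs)), mul_assoc]

variable [MeasurableSpace Y]

lemma measurable_cusum (hℓ : Measurable ℓ) (t : ℕ) : Measurable[history Y t] (cusum ℓ t) := by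
  induction t with
  | zero => exact measurable_const
  | succ t ih =>
    have h := ih.mono (history_mono t.le_succ) le_rfl
    exact (measurable_const.max h).mul (hℓ.comp (measurable_eval_history t.lt_succ_self))

variable {Q Q' : Measure Y} [IsProbabilityMeasure Q] [IsProbabilityMeasure Q']

/-- If the conditional mean delay of a stopping time is at most `d` for every change point, then
the CuSum process run until this time satisfies Moustakides' inequality. -/
lemma sum_lintegral_max_one_cusum_le (hℓ : Measurable ℓ) (h0 : ∀ y, 0 ≤ ℓ y)
    (hQ : Q' = Q.withDensity fun y => ENNReal.ofReal (ℓ y))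
    {τ : (ℕ → Y) → WithTop ℕ} (hτ : IsStoppingTime (sampleFiltration Y) τ) {d : ℝ≥0∞}
    (hd : ∀ s : ℕ, ∀ w : (ℕ → Y) → ℝ≥0∞, Measurable[history Y s] w →
      ∫⁻ x, (ENat.toENNReal (τ x) - ((s + 1 : ℕ) : ℝ≥0∞)) * w x
        ∂Measure.infinitePi (fun i => if i < s then Q else Q') ≤
      d * ∫⁻ x, w x ∂Measure.infinitePi (fun i => if i < s then Q else Q')) (m : ℕ) :
    ∑ t ∈ Finset.range m, ∫⁻ x, {x | (t : WithTop ℕ) < τ x}.indicator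
        (fun x => ENNReal.ofReal (max 1 (cusum ℓ t x))) x ∂Measure.infinitePi (fun _ => Q) ≤
      (d + 1) * ∑ s ∈ Finset.range m, ∫⁻ x, {x | (s : WithTop ℕ) < τ x}.indicator
        (fun x => ENNReal.ofReal (1 - cusum ℓ s x)) x ∂Measure.infinitePi (fun _ => Q) := by
  set P := Measure.infinitePi (fun _ : ℕ => Q)
  set law : ℕ → Measure (ℕ → Y) := fun s => Measure.infinitePi (fun i => if i < s then Q else Q')
    with hlaw
  have hprob : ∀ s i, IsProbabilityMeasure ((fun i : ℕ => if i < s then Q else Q') i) := by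
    intro s i
    dsimp only
    split_ifs <;> infer_instance
  set w : ℕ → (ℕ → Y) → ℝ≥0∞ := fun s => {x | (s : WithTop ℕ) < τ x}.indicator
    (fun x => ENNReal.ofReal (1 - cusum ℓ s x)) with hw
  have hlt := IsStoppingTime.measurableSet_history_lt hτ
  have hwm : ∀ s, Measurable[history Y s] (w s) := fun s =>
    (ENNReal.measurable_ofReal.comp ((measurable_cusum hℓ s).const_sub 1)).indicator (hlt s)
  have hDm : Measurable fun y => ENNReal.ofReal (ℓ y) := ENNReal.measurable_ofReal.comp hℓ
  have hpre : ∀ s, ∫⁻ x, w s x ∂law s = ∫⁻ x, w s x ∂P := fun s => by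
    have := hprob s
    exact lintegral_infinitePi_congr_history (fun i hi => if_pos hi) (hwm s)
  have hcm : ∀ s t : ℕ, s ≤ t → ∫⁻ x, {x | (t : WithTop ℕ) < τ x}.indicator (w s) x ∂law s =
      ∫⁻ x, {x | (t : WithTop ℕ) < τ x}.indicator (w s) x *
        ∏ i ∈ Finset.Ico s t, ENNReal.ofReal (ℓ (x i)) ∂P := by
    intro s t hst
    have := hprob s
    have hmeas : Measurable[history Y t] ({x | (t : WithTop ℕ) < τ x}.indicator (w s)) :=
      ((hwm s).mono (history_mono hst) le_rfl).indicator (hlt t)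
    rw [hlaw, lintegral_infinitePi_withDensity_history (Q := fun _ => Q) (t := t)
      (D := fun i y => if i < s then 1 else ENNReal.ofReal (ℓ y)) ?_ ?_ hmeas]
    · refine lintegral_congr fun x => ?_
      congr 1
      rw [← Finset.prod_range_mul_prod_Ico _ hst, Finset.prod_eq_one (s := Finset.range s),
        one_mul]
      · refine Finset.prod_congr rfl fun i hi => ?_
        rw [if_neg (not_lt.2 (Finset.mem_Ico.1 hi).1)]
      · intro i hi
        rw [if_pos (Finset.mem_range.1 hi)]
    · intro i
      split_ifs
      · exact measurable_const
      · exact hDm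
    · intro i _
      split_ifs
      · simp
      · exact hQ
  -- For a change after `s` samples, that is `ν = s + 1`, the terms `t > s` add up to at most the
  -- weighted delay. The term `t = s` is the extra 1 in `d + 1`.
  have hrow : ∀ s, ∑ t ∈ Finset.Ico s m, ∫⁻ x, {x | (t : WithTop ℕ) < τ x}.indicator (w s) x *
        ∏ i ∈ Finset.Ico s t, ENNReal.ofReal (ℓ (x i)) ∂P ≤ (d + 1) * ∫⁻ x, w s x ∂P := by
    intro s
    have hms : ∀ t : ℕ, Measurable ({x | (t : WithTop ℕ) < τ x}.indicator (w s)) := fun t =>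
      ((hwm s).mono (history_le_pi s) le_rfl).indicator (history_le_pi t _ (hlt t))
    have hpt : ∀ x, ∑ t ∈ Finset.Ico s m, {x | (t : WithTop ℕ) < τ x}.indicator (w s) x ≤
        (ENat.toENNReal (τ x) - ((s + 1 : ℕ) : ℝ≥0∞)) * w s x + w s x := by
      intro x
      have h1 : ∑ t ∈ Finset.Ico (s + 1) m, {x | (t : WithTop ℕ) < τ x}.indicator (w s) x ≤
          (ENat.toENNReal (τ x) - ((s + 1 : ℕ) : ℝ≥0∞)) * w s x := by
        rw [toENNReal_sub_eq_tsum_indicator, Finset.sum_Ico_eq_sum_range]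
        calc _ = (∑ j ∈ Finset.range (m - (s + 1)),
              {x | ((s + 1 + j : ℕ) : WithTop ℕ) < τ x}.indicator 1 x) * w s x := by
              rw [Finset.sum_mul]
              refine Finset.sum_congr rfl fun j _ => ?_
              simp only [Set.indicator]
              split_ifs <;> simp
          _ ≤ _ := by
              gcongr
              exact ENNReal.sum_le_tsum _
      rcases lt_or_ge s m with hsm | hsm
      · rw [Finset.sum_eq_sum_Ico_succ_bot hsm, add_comm]
        exact add_le_add h1 (Set.indicator_le_self _ _ _)
      · rw [Finset.Ico_eq_empty (not_lt.2 hsm), Finset.sum_empty]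
        exact zero_le
    calc _ = ∑ t ∈ Finset.Ico s m, ∫⁻ x, {x | (t : WithTop ℕ) < τ x}.indicator (w s) x ∂law s :=
          Finset.sum_congr rfl fun t ht => (hcm s t (Finset.mem_Ico.1 ht).1).symm
      _ = ∫⁻ x, ∑ t ∈ Finset.Ico s m, {x | (t : WithTop ℕ) < τ x}.indicator (w s) x ∂law s :=
          (lintegral_finsetSum _ fun t _ => hms t).symm
      _ ≤ ∫⁻ x, ((ENat.toENNReal (τ x) - ((s + 1 : ℕ) : ℝ≥0∞)) * w s x + w s x) ∂law s :=
          lintegral_mono hpt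
      _ ≤ d * ∫⁻ x, w s x ∂law s + ∫⁻ x, w s x ∂law s := by
          rw [lintegral_add_right _ ((hwm s).mono (history_le_pi s) le_rfl)]
          gcongr
          exact hd s _ (hwm s)
      _ = _ := by rw [hpre, add_mul, one_mul]
  rw [Finset.mul_sum]
  refine le_trans (le_of_eq ?_) (Finset.sum_le_sum fun s _ => hrow s)
  have hswap : ∀ f : ℕ → ℕ → ℝ≥0∞, ∑ s ∈ Finset.range m, ∑ t ∈ Finset.Ico s m, f s t =
      ∑ t ∈ Finset.range m, ∑ s ∈ Finset.range (t + 1), f s t := fun f => by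
    refine Finset.sum_comm' fun s t => ?_
    simp only [Finset.mem_range, Finset.mem_Ico]
    omega
  rw [hswap]
  refine Finset.sum_congr rfl fun t _ => ?_
  rw [← lintegral_finsetSum]
  · refine lintegral_congr fun x => ?_
    by_cases hx : x ∈ {x | (t : WithTop ℕ) < τ x}
    · rw [Set.indicator_of_mem hx, ← sum_cusum_eq h0]
      refine Finset.sum_congr rfl fun s hs => ?_
      have hxs : x ∈ {x | (s : WithTop ℕ) < τ x} :=
        lt_of_le_of_lt (b := (t : WithTop ℕ))
          (Nat.cast_le.2 (Nat.lt_succ_iff.1 (Finset.mem_range.1 hs))) hx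
      simp only [hw, Set.indicator_of_mem hx, Set.indicator_of_mem hxs]
    · simp [Set.indicator_of_notMem hx]
  · intro s hs
    exact (((hwm s).mono (history_le_pi s) le_rfl).indicator (history_le_pi t _ (hlt t))).mul
      (Finset.measurable_prod _ fun i _ => hDm.comp (measurable_pi_apply i))

/-- A stopping time whose conditional mean delay is at most `d` for every change point has mean at
most of the order `exp (I d)` under the law without change. -/
theorem lintegral_stoppingTime_le (hℓ : Measurable ℓ) (h0 : ∀ y, 0 ≤ ℓ y)
    (hQ : Q' = Q.withDensity fun y => ENNReal.ofReal (ℓ y)) {I : ℝ}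
    (hint : Integrable (fun y => ℓ y * Real.log (ℓ y)) Q)
    (hIeq : ∫ y, ℓ y * Real.log (ℓ y) ∂Q = I) (hI : 0 < I)
    {τ : (ℕ → Y) → WithTop ℕ} (hτ : IsStoppingTime (sampleFiltration Y) τ) {d : ℝ≥0}
    (hd : ∀ s : ℕ, ∀ w : (ℕ → Y) → ℝ≥0∞, Measurable[history Y s] w →
      ∫⁻ x, (ENat.toENNReal (τ x) - ((s + 1 : ℕ) : ℝ≥0∞)) * w x
        ∂Measure.infinitePi (fun i => if i < s then Q else Q') ≤
      d * ∫⁻ x, w x ∂Measure.infinitePi (fun i => if i < s then Q else Q')) :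
    ENNReal.ofReal (1 - ∫ y, √(ℓ y) ∂Q) *
      ∫⁻ x, ENat.toENNReal (τ x) ∂Measure.infinitePi (fun _ => Q) ≤
      ENNReal.ofReal (Real.exp (I * (d + 2)) / I) := by
  have hmass : ∫⁻ y, ENNReal.ofReal (ℓ y) ∂Q = 1 := by
    have : Q' Set.univ = 1 := measure_univ
    rwa [hQ, withDensity_apply _ .univ, setLIntegral_univ] at this
  have hℓi : Integrable ℓ Q := by
    refine ⟨hℓ.aestronglyMeasurable, ?_⟩
    rw [hasFiniteIntegral_iff_ofReal (Eventually.of_forall h0), hmass]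
    exact ENNReal.one_lt_top
  have hℓ1 : ∫ y, ℓ y ∂Q = 1 := by
    rw [integral_eq_lintegral_of_nonneg_ae (Eventually.of_forall h0) hℓ.aestronglyMeasurable,
      hmass, ENNReal.toReal_one]
  set P := Measure.infinitePi (fun _ : ℕ => Q) with hP
  set δ := ENNReal.ofReal (1 - ∫ y, √(ℓ y) ∂Q) with hδ
  -- The price of reflection equals the factor in Moustakides' inequality, so the terms `b t` cancel
  -- after telescoping.
  set d' : ℝ := d + 1 with hd'
  have hd'0 : 0 ≤ d' := by positivity
  have hd'eq : ENNReal.ofReal d' = d + 1 := by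
    rw [hd', ENNReal.ofReal_add d.coe_nonneg zero_le_one, ENNReal.ofReal_coe_nnreal,
      ENNReal.ofReal_one]
  have hlt := IsStoppingTime.measurableSet_history_lt hτ
  have hlt' : ∀ t : ℕ, MeasurableSet {x | (t : WithTop ℕ) < τ x} :=
    fun t => history_le_pi t _ (hlt t)
  have hVm := measurable_cusumLyapunov I d'
  have hMm := measurable_cusum (Y := Y) hℓ
  have hMm' := fun t => (hMm t).mono (history_le_pi t) le_rfl
  set a : ℕ → ℝ≥0∞ := fun t => ∫⁻ x, {x | (t : WithTop ℕ) < τ x}.indicator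
    (fun x => ENNReal.ofReal (cusumLyapunov I d' (cusum ℓ t x))) x ∂P with ha
  set b : ℕ → ℝ≥0∞ := fun t => ∫⁻ x, {x | (t : WithTop ℕ) < τ x}.indicator
    (fun x => ENNReal.ofReal (1 - cusum ℓ t x)) x ∂P with hb
  set U : ℕ → ℝ≥0∞ := fun t => ∫⁻ x, {x | (t : WithTop ℕ) < τ x}.indicator
    (fun x => ENNReal.ofReal (max 1 (cusum ℓ t x))) x ∂P with hU
  set p : ℕ → ℝ≥0∞ := fun t => P {x | (t : WithTop ℕ) < τ x} with hp
  have hstep : ∀ t, a (t + 1) + (ENNReal.ofReal d' * b t + δ * p t) ≤ a t + U t := by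
    intro t
    set F : (ℕ → Y) × Y → ℝ≥0∞ := fun z => {x | (t : WithTop ℕ) < τ x}.indicator 1 z.1 *
      ENNReal.ofReal (cusumLyapunov I d' (max 1 (cusum ℓ t z.1) * ℓ z.2)) with hF
    have hFm : Measurable[(history Y t).prod inferInstance] F := by
      let := history Y t
      refine ((measurable_one.indicator (hlt t)).comp measurable_fst).mul
        (ENNReal.measurable_ofReal.comp (hVm.comp ?_))
      exact ((measurable_const.max (hMm t)).comp measurable_fst).mul (hℓ.comp measurable_snd)
    have h1 : a (t + 1) ≤ ∫⁻ x, F (x, x t) ∂P := by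
      refine lintegral_mono fun x => ?_
      by_cases hx : x ∈ {x | ((t + 1 : ℕ) : WithTop ℕ) < τ x}
      · have hxt : x ∈ {x | (t : WithTop ℕ) < τ x} :=
          lt_trans (b := ((t + 1 : ℕ) : WithTop ℕ)) (Nat.cast_lt.2 t.lt_succ_self) hx
        simp only [hF, Set.indicator_of_mem hx, Set.indicator_of_mem hxt, Pi.one_apply, one_mul]
        exact le_rfl
      · rw [Set.indicator_of_notMem hx]; exact zero_le
    have hbm : Measurable ({x | (t : WithTop ℕ) < τ x}.indicator
        (fun x => ENNReal.ofReal (1 - cusum ℓ t x))) :=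
      (ENNReal.measurable_ofReal.comp ((hMm' t).const_sub 1)).indicator (hlt' t)
    have hpm : Measurable ({x | (t : WithTop ℕ) < τ x}.indicator (1 : (ℕ → Y) → ℝ≥0∞)) :=
      measurable_one.indicator (hlt' t)
    have hum : Measurable ({x | (t : WithTop ℕ) < τ x}.indicator
        (fun x => ENNReal.ofReal (max 1 (cusum ℓ t x)))) :=
      (ENNReal.measurable_ofReal.comp (measurable_const.max (hMm' t))).indicator (hlt' t)
    calc _ ≤ ∫⁻ x, F (x, x t) ∂P + (ENNReal.ofReal d' * b t + δ * p t) := by gcongr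
      _ = ∫⁻ x, (∫⁻ y, F (x, y) ∂Q + (ENNReal.ofReal d' * {x | (t : WithTop ℕ) < τ x}.indicator
            (fun x => ENNReal.ofReal (1 - cusum ℓ t x)) x +
            δ * {x | (t : WithTop ℕ) < τ x}.indicator 1 x)) ∂P := by
          rw [lintegral_add_right _ ((hbm.const_mul _).fun_add (hpm.const_mul _)),
            lintegral_add_left (hbm.const_mul _), lintegral_const_mul _ hbm,
            lintegral_const_mul _ hpm, lintegral_indicator_one (hlt' t), hP,
            lintegral_infinitePi_history_eval _ t hFm]
      _ ≤ ∫⁻ x, ({x | (t : WithTop ℕ) < τ x}.indicator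
            (fun x => ENNReal.ofReal (cusumLyapunov I d' (cusum ℓ t x))) x +
            {x | (t : WithTop ℕ) < τ x}.indicator
            (fun x => ENNReal.ofReal (max 1 (cusum ℓ t x))) x) ∂P := by
          refine lintegral_mono fun x => ?_
          by_cases hx : x ∈ {x | (t : WithTop ℕ) < τ x}
          · simp only [hF, Set.indicator_of_mem hx, Pi.one_apply, one_mul, mul_one]
            exact lintegral_cusumLyapunov_le hℓi h0 hℓ1 hint hIeq hI hd'0 (cusum_nonneg h0 t x)
          · simp [hF, Set.indicator_of_notMem hx]
      _ = _ := lintegral_add_right _ hum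
  have htel : ∀ m, a m + ∑ t ∈ Finset.range m, (ENNReal.ofReal d' * b t + δ * p t) ≤
      a 0 + ∑ t ∈ Finset.range m, U t := by
    intro m
    induction m with
    | zero => simp
    | succ m ih =>
      rw [Finset.sum_range_succ, Finset.sum_range_succ]
      calc _ = (a (m + 1) + (ENNReal.ofReal d' * b m + δ * p m)) +
            ∑ t ∈ Finset.range m, (ENNReal.ofReal d' * b t + δ * p t) := by ring
        _ ≤ (a m + U m) + ∑ t ∈ Finset.range m, (ENNReal.ofReal d' * b t + δ * p t) := by
            exact add_le_add_left (hstep m) _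
        _ = (a m + ∑ t ∈ Finset.range m, (ENNReal.ofReal d' * b t + δ * p t)) + U m := by ring
        _ ≤ (a 0 + ∑ t ∈ Finset.range m, U t) + U m := by gcongr
        _ = _ := by ring
  have ha0 : a 0 ≤ ENNReal.ofReal (Real.exp (I * (d + 2)) / I) := by
    calc a 0 ≤ ∫⁻ _, ENNReal.ofReal (Real.exp (I * (d + 2)) / I) ∂P := by
          refine lintegral_mono fun x => (Set.indicator_le_self _ _ _).trans ?_
          simp only [cusum, cusumLyapunov_zero]
          refine le_of_eq ?_
          congr 4
          rw [hd']; ring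
      _ = _ := by simp
  have hbfin : ∀ t, b t ≤ 1 := by
    intro t
    calc b t ≤ ∫⁻ _, 1 ∂P := by
          refine lintegral_mono fun x => (Set.indicator_le_self _ _ _).trans ?_
          rw [ENNReal.ofReal_le_one]
          linarith [cusum_nonneg h0 t x]
      _ = 1 := by simp
  rw [lintegral_toENNReal_eq_tsum (IsStoppingTime.measurableSet_pi_le hτ), ← ENNReal.tsum_mul_left]
  refine ENNReal.tsum_le_of_sum_range_le fun m => ?_
  have h1 := htel m
  have h2 := sum_lintegral_max_one_cusum_le hℓ h0 hQ hτ hd m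
  rw [← hd'eq] at h2
  rw [Finset.sum_add_distrib, ← Finset.mul_sum] at h1
  -- Cancellation in `ℝ≥0∞` needs finiteness; this is why the sums are stopped at `m`.
  have hfin : ENNReal.ofReal d' * ∑ t ∈ Finset.range m, b t ≠ ∞ :=
    ENNReal.mul_ne_top ENNReal.ofReal_ne_top
      (ENNReal.sum_ne_top.2 fun t _ => ((hbfin t).trans_lt ENNReal.one_lt_top).ne)
  have h3 : ENNReal.ofReal d' * ∑ t ∈ Finset.range m, b t + ∑ t ∈ Finset.range m, δ * p t ≤
      ENNReal.ofReal d' * ∑ t ∈ Finset.range m, b t +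
        ENNReal.ofReal (Real.exp (I * (d + 2)) / I) := by
    refine le_add_self.trans (h1.trans ?_)
    rw [add_comm]
    exact add_le_add h2 ha0
  exact (ENNReal.add_le_add_iff_left hfin).1 h3

end Cusum

/-! ### From the network to the i.i.d. problem, and the two asymptotic bounds. -/

lemma lintegral_mul_le_of_essSup_condLExp_le {Ω : Type*} {m m0 : MeasurableSpace Ω} (hm : m ≤ m0)
    (P : Measure[m0] Ω) [IsFiniteMeasure P] {f w : Ω → ℝ≥0∞} {c : ℝ≥0∞} (hf : Measurable[m0] f)
    (hw : Measurable[m] w) (h : essSup (condLExp m P f) P ≤ c) :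
    ∫⁻ x, f x * w x ∂P ≤ c * ∫⁻ x, w x ∂P := by
  have hc : ∀ᵐ x ∂P, condLExp m P f x ≤ c :=
    (ENNReal.ae_le_essSup _).mono fun x hx => hx.trans h
  have hle : (P.withDensity f).trim hm ≤ (c • P).trim hm := by
    refine Measure.le_iff.2 fun A hA => ?_
    rw [trim_measurableSet_eq hm hA, trim_measurableSet_eq hm hA, withDensity_apply _ (hm _ hA),
      ← setLIntegral_condLExp hm P f hA]
    calc _ ≤ ∫⁻ _ in A, c ∂P := lintegral_mono_ae (ae_restrict_of_ae hc)
      _ = _ := by simp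
  calc ∫⁻ x, f x * w x ∂P = ∫⁻ x, w x ∂(P.withDensity f) := by
        rw [lintegral_withDensity_eq_lintegral_mul _ hf (hw.mono hm le_rfl)]
        rfl
    _ = ∫⁻ x, w x ∂((P.withDensity f).trim hm) := (lintegral_trim hm hw).symm
    _ ≤ ∫⁻ x, w x ∂((c • P).trim hm) := lintegral_mono' hle le_rfl
    _ = ∫⁻ x, w x ∂(c • P) := lintegral_trim hm hw
    _ = _ := lintegral_smul_measure _ _

namespace SensorNetwork

variable {X : Type*} [MeasurableSpace X] {μ : Measure X} {K n : ℕ} (N : SensorNetwork μ K n)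

lemma WARL_le_lintegral_mixturePathLaw {τ : (ℕ → Fin n → X) → WithTop ℕ}
    (hτ : IsStoppingTime (sampleFiltration (Fin n → X)) τ) :
    N.WARL τ ≤ ∫⁻ x, ENat.toENNReal (τ x) ∂N.mixturePathLaw (noAnomaly K) := by
  have hm := measurable_toENNReal_sub (IsStoppingTime.measurableSet_pi_le hτ) 0
  simp only [Nat.cast_zero, tsub_zero] at hm
  have h := N.lintegral_mixturePathLaw_le (S := noAnomaly K) (f := fun _ => N.WARL τ)
    measurable_const hm fun L => by
      rw [lintegral_const, measure_univ, mul_one]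
      exact iInf_le _ L
  rwa [lintegral_const, measure_univ, mul_one] at h

/-- A conditional mean is not linear in the law, but its weighted form is. With the same constant
for all label sequences, it survives averaging over them. -/
lemma lintegral_mixturePathLaw_delay_le {τ : (ℕ → Fin n → X) → WithTop ℕ}
    (hτ : IsStoppingTime (sampleFiltration (Fin n → X)) τ) (k : Fin K) (s : ℕ)
    {w : (ℕ → Fin n → X) → ℝ≥0∞} (hw : Measurable[history (Fin n → X) s] w) :
    ∫⁻ x, (ENat.toENNReal (τ x) - ((s + 1 : ℕ) : ℝ≥0∞)) * w x
        ∂N.mixturePathLaw (staticTrajectory k (s + 1)) ≤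
      N.WADD τ * ∫⁻ x, w x ∂N.mixturePathLaw (staticTrajectory k (s + 1)) := by
  have hm := measurable_toENNReal_sub (IsStoppingTime.measurableSet_pi_le hτ) (s + 1)
  have hw' := hw.mono (history_le_pi s) le_rfl
  rw [← lintegral_const_mul _ hw']
  refine N.lintegral_mixturePathLaw_le (hm.mul hw') (hw'.const_mul _) fun L => ?_
  rw [lintegral_const_mul _ hw']
  refine lintegral_mul_le_of_essSup_condLExp_le (history_le_pi s) _ hm hw ?_
  exact le_iSup₂_of_le (s + 1) (by omega) (le_iSup₂_of_le k L le_rfl)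

variable [SigmaFinite μ]

/-- The universal lower bound for the delay of the stopping times that meet the false alarm
constraint. -/
theorem exists_le_optimalWADD_add (hI_pos : N.klInfoMin ≠ 0) (hI_fin : N.klInfoMin ≠ ∞) :
    ∃ C : ℝ≥0, ∀ γ : ℝ, 0 < γ →
      ENNReal.ofReal (Real.log γ) / N.klInfoMin ≤ N.optimalWADD γ + C := by
  -- An empty infimum would be `∞`.
  have hne : Nonempty (Fin K) := by
    by_contra h
    rw [not_nonempty_iff] at h
    exact hI_fin (by simp [klInfoMin])
  obtain ⟨k, hk⟩ := exists_eq_ciInf_of_finite (f := N.klInfo)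
  change N.klInfo k = N.klInfoMin at hk
  set I := N.klInfoMin.toReal with hI
  have hIpos : 0 < I := ENNReal.toReal_pos hI_pos hI_fin
  have hIeq : N.klInfoMin = ENNReal.ofReal I := (ENNReal.ofReal_toReal hI_fin).symm
  obtain ⟨hac, hint⟩ := (N.klInfo_ne_top_iff k).1 (hk ▸ hI_fin)
  set Q := N.mixtureLaw none with hQdef
  set Q' := N.mixtureLaw (some k) with hQ'def
  set ℓ : (Fin n → X) → ℝ := fun y => (N.mixtureLR k y).toReal with hℓ
  have hℓm : Measurable ℓ := (N.measurable_mixtureLR k).ennreal_toReal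
  have hℓ0 : ∀ y, 0 ≤ ℓ y := fun y => ENNReal.toReal_nonneg
  have hLR := N.mixtureLaw_eq_withDensity_of_ac hac
  have hQ : Q' = Q.withDensity fun y => ENNReal.ofReal (ℓ y) := by
    rw [hQ'def, hLR]
    refine withDensity_congr_ae ?_
    filter_upwards [N.ae_mixtureLR_ne_top k] with y hy using (ENNReal.ofReal_toReal hy).symm
  have hlog : ∀ y, (N.mixtureLLR k y).toReal = Real.log (ℓ y) := fun y => by
    rw [mixtureLLR_eq_log, toReal_ennrealLog]
  have hfin : ∀ᵐ y ∂Q, ENNReal.ofReal (ℓ y) < ∞ :=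
    Eventually.of_forall fun y => ENNReal.ofReal_lt_top
  have hm : Measurable fun y => ENNReal.ofReal (ℓ y) := ENNReal.measurable_ofReal.comp hℓm
  have hint' : Integrable (fun y => ℓ y * Real.log (ℓ y)) Q := by
    simp_rw [hlog] at hint
    rw [hQ, integrable_withDensity_iff_integrable_smul' hm hfin] at hint
    simpa [ENNReal.toReal_ofReal (hℓ0 _)] using hint
  have hIval : ∫ y, ℓ y * Real.log (ℓ y) ∂Q = I := by
    rw [hI, ← hk, N.toReal_klInfo hac]
    simp_rw [hlog]
    rw [← hQ'def, hQ, integral_withDensity_eq_integral_toReal_smul hm hfin]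
    simp [ENNReal.toReal_ofReal (hℓ0 _)]
  set δ : ℝ := 1 - ∫ y, √(ℓ y) ∂Q with hδ
  have hδpos : 0 < δ := by
    have hmass : ∫⁻ y, ENNReal.ofReal (ℓ y) ∂Q = 1 := by
      have : Q' Set.univ = 1 := measure_univ
      rwa [hQ, withDensity_apply _ .univ, setLIntegral_univ] at this
    have hℓi : Integrable ℓ Q := by
      refine ⟨hℓm.aestronglyMeasurable, ?_⟩
      rw [hasFiniteIntegral_iff_ofReal (Eventually.of_forall hℓ0), hmass]
      exact ENNReal.one_lt_top
    have hℓ1 : ∫ y, ℓ y ∂Q = 1 := by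
      rw [integral_eq_lintegral_of_nonneg_ae (Eventually.of_forall hℓ0)
        hℓm.aestronglyMeasurable, hmass, ENNReal.toReal_one]
    exact sub_pos.2 (integral_sqrt_lt_one hℓi hℓ0 hℓ1 (hIval ▸ hIpos))
  -- From `δ γ ≤ exp (I (d + 2)) / I`, solved for `d` after taking logarithms.
  set C : ℝ := 2 + |Real.log (δ * I)| / I with hC
  have hC0 : 0 ≤ C := by positivity
  refine ⟨C.toNNReal, fun γ hγ => ?_⟩
  rw [← tsub_le_iff_right]
  refine le_iInf fun τ => le_iInf fun hτ => le_iInf fun hWARL => ?_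
  rw [tsub_le_iff_right]
  by_cases htop : N.WADD τ = ∞
  · rw [htop, top_add]; exact le_top
  set d := (N.WADD τ).toNNReal with hd
  have hdeq : N.WADD τ = d := (ENNReal.coe_toNNReal htop).symm
  have hlaw : ∀ s, N.mixturePathLaw (staticTrajectory k (s + 1)) =
      Measure.infinitePi (fun i => if i < s then Q else Q') := by
    intro s
    unfold mixturePathLaw
    congr 1
    funext i
    simp only [staticTrajectory, Nat.add_lt_add_iff_right]
    split_ifs <;> rfl
  have hmain := lintegral_stoppingTime_le hℓm hℓ0 hQ hint' hIval hIpos hτ (d := d) fun s w hw => by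
    have := N.lintegral_mixturePathLaw_delay_le hτ k s hw
    rwa [hlaw, hdeq] at this
  have hγle : ENNReal.ofReal γ ≤
      ∫⁻ x, ENat.toENNReal (τ x) ∂Measure.infinitePi (fun _ : ℕ => Q) :=
    hWARL.trans (N.WARL_le_lintegral_mixturePathLaw hτ)
  have hreal : δ * γ ≤ Real.exp (I * (d + 2)) / I := by
    rw [← ENNReal.ofReal_le_ofReal_iff (by positivity), ENNReal.ofReal_mul hδpos.le]
    exact (mul_le_mul_right hγle _).trans hmain
  have hlogle : Real.log γ / I ≤ d + C := by
    rw [le_div_iff₀ hIpos] at hreal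
    have h1 := Real.log_le_log (by positivity) hreal
    rw [Real.log_exp, mul_right_comm, Real.log_mul (by positivity) hγ.ne'] at h1
    have h2 := neg_le_abs (Real.log (δ * I))
    rw [div_le_iff₀ hIpos, hC, add_mul, add_mul, div_mul_cancel₀ _ hIpos.ne']
    linarith
  calc ENNReal.ofReal (Real.log γ) / N.klInfoMin = ENNReal.ofReal (Real.log γ / I) := by
        rw [hIeq, ENNReal.ofReal_div_of_pos hIpos]
    _ ≤ ENNReal.ofReal (d + C) := ENNReal.ofReal_le_ofReal hlogle
    _ = N.WADD τ + C.toNNReal := by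
        rw [ENNReal.ofReal_add d.coe_nonneg hC0, ENNReal.ofReal_coe_nnreal, hdeq]
        rfl

/-- The worst-case delay of the GM-CuSum time. -/
theorem exists_WADD_gmCuSum_le (hI_pos : N.klInfoMin ≠ 0) (hI_fin : N.klInfoMin ≠ ∞)
    (h2 : ∀ k, N.klInfo k = N.klInfoMin →
      MemLp (fun x => (N.mixtureLLR k x).toReal) 2 (N.mixtureLaw (some k))) :
    ∃ C : ℝ≥0, ∀ b : ℝ, 0 < b →
      N.WADD (N.gmCuSum b) ≤ ENNReal.ofReal b / N.klInfoMin + C := by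
  choose C hC using fun k => N.exists_essSup_delay_gmCuSum_le hI_pos hI_fin k (h2 k)
  refine ⟨∑ k, C k, fun b hb => ?_⟩
  refine iSup₂_le fun ν hν => iSup₂_le fun k L => (hC k b hb ν hν L).trans ?_
  gcongr
  exact Finset.single_le_sum (f := C) (fun _ _ => zero_le) (Finset.mem_univ k)

end SensorNetwork

end UnlabeledQCD

end

theorem theorem3 {X : Type*} [MeasurableSpace X] (μ : Measure X) [SigmaFinite μ] (K n : ℕ)
    (N : UnlabeledQCD.SensorNetwork μ K n)
    (hI_pos : N.klInfoMin ≠ 0) (hI_fin : N.klInfoMin ≠ ∞) :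
    -- for every `γ`, the threshold `log (K γ)` makes the GM-CuSum time admissible
    (∀ γ : ℝ, 0 < γ →
      IsStoppingTime (UnlabeledQCD.sampleFiltration (Fin n → X))
          (N.gmCuSum (Real.log (K * γ))) ∧
        ENNReal.ofReal γ ≤ N.WARL (N.gmCuSum (Real.log (K * γ)))) ∧
    -- universal lower bound
    (∃ C : ℝ≥0, ∀ᶠ γ : ℝ in atTop,
      ENNReal.ofReal (Real.log γ) / N.klInfoMin ≤ N.optimalWADD γ + C) ∧
    -- second-order asymptotic optimality
    ((∀ k, N.klInfo k = N.klInfoMin →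
        MemLp (fun x => (N.mixtureLLR k x).toReal) 2 (N.mixtureLaw (some k))) →
      ∃ C : ℝ≥0, ∀ᶠ γ : ℝ in atTop,
        N.WADD (N.gmCuSum (Real.log (K * γ))) ≤ N.optimalWADD γ + C ∧
        N.WADD (N.gmCuSum (Real.log (K * γ))) ≤
          ENNReal.ofReal (Real.log γ) / N.klInfoMin + C ∧
        ENNReal.ofReal (Real.log γ) / N.klInfoMin ≤
          N.WADD (N.gmCuSum (Real.log (K * γ))) + C) := by
  have hK : 0 < K := by
    rcases Nat.eq_zero_or_pos K with rfl | h
    · exact absurd (by simp [UnlabeledQCD.SensorNetwork.klInfoMin]) hI_fin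
    · exact h
  have hadm : ∀ γ : ℝ, 0 < γ →
      IsStoppingTime (UnlabeledQCD.sampleFiltration (Fin n → X))
          (N.gmCuSum (Real.log (K * γ))) ∧
        ENNReal.ofReal γ ≤ N.WARL (N.gmCuSum (Real.log (K * γ))) := fun γ hγ =>
    ⟨N.isStoppingTime_gmCuSum _, N.le_WARL_gmCuSum hγ hK⟩
  obtain ⟨C₁, hC₁⟩ := N.exists_le_optimalWADD_add hI_pos hI_fin
  refine ⟨hadm, ⟨C₁, (eventually_gt_atTop 0).mono hC₁⟩, fun h2 => ?_⟩
  obtain ⟨C₂, hC₂⟩ := N.exists_WADD_gmCuSum_le hI_pos hI_fin h2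
  have hK1 : (1 : ℝ) ≤ K := by exact_mod_cast hK
  have hcfin : ENNReal.ofReal (Real.log K) / N.klInfoMin ≠ ∞ :=
    ENNReal.div_ne_top ENNReal.ofReal_ne_top hI_pos
  -- The delay caused by the threshold `log (K γ)` in place of `log γ`.
  set C₃ : ℝ≥0 := (ENNReal.ofReal (Real.log K) / N.klInfoMin).toNNReal with hC₃
  have hC₃eq : ENNReal.ofReal (Real.log K) / N.klInfoMin = C₃ := (ENNReal.coe_toNNReal hcfin).symm
  refine ⟨C₁ + (C₃ + C₂), (eventually_gt_atTop 1).mono fun γ hγ => ?_⟩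
  have hγ0 : 0 < γ := by linarith
  have hlog : Real.log (K * γ) = Real.log γ + Real.log K := by
    rw [Real.log_mul (by positivity) hγ0.ne', add_comm]
  have hup : N.WADD (N.gmCuSum (Real.log (K * γ))) ≤
      ENNReal.ofReal (Real.log γ) / N.klInfoMin + (C₃ + C₂) := by
    have hb : 0 < Real.log (K * γ) := by
      have h3 := Real.log_pos hγ
      have h4 := Real.log_nonneg hK1
      linarith
    refine (hC₂ _ hb).trans ?_
    rw [hlog, ENNReal.ofReal_add (Real.log_nonneg hγ.le) (Real.log_nonneg hK1), ENNReal.add_div,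
      hC₃eq, add_assoc]
  have hopt : N.optimalWADD γ ≤ N.WADD (N.gmCuSum (Real.log (K * γ))) :=
    iInf_le_of_le _ (iInf₂_le_of_le (hadm γ hγ0).1 (hadm γ hγ0).2 le_rfl)
  push_cast
  refine ⟨?_, hup.trans ?_, ?_⟩
  · rw [← add_assoc]
    exact hup.trans (add_le_add_left (hC₁ γ hγ0) _)
  · exact add_le_add le_rfl le_add_self
  · refine (hC₁ γ hγ0).trans (add_le_add hopt le_self_add)
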